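/- Let $d\ge 0$ and $m\ge 2$ be integers. Consider finite words over the alphabet $\{0,\dots,m-1\}$, read in a fixed direction (from the lowest digit on), as the vertices of the rooted $m$-ary tree $T_m$. Let $L_{-1,m}=\mathrm{Sym}(m)$ act on $T_m$ by permuting the first letter read. For $k\ge 0$, a word $w$ of length $k$ in the letters $\{1,\dots,m-1\}$, and an element $\sigma$ of $\mathrm{Sym}(m)\wr\mathrm{Sym}(m-1)$ (the automorphisms of the first two levels of $T_m$ that fix $0$ and its children), let $\lambda_{w,\sigma}\in\mathrm{Aut}(T_m)$ be the automorphism that acts on a word as follows: if the first $k$ nonzero letters of the word agree with $w$, then the $(k+1)$st nonzero letter and the letter immediately following it are permuted by $\sigma$; otherwise nothing is changed. Let $L_{k,m}$ be the subgroup of $\mathrm{Aut}(T_m)$ generated by all $\lambda_{w,\sigma}$ with $|w|=k$. The fractal mother graph $\mathcal G(d,m,n)$ is the Schreier graph on the set $\{0,\dots,m-1\}^n$ of words of length $n$ with respect to the generating set $\bigcup_{-1\le k\le d}L_{k,m}$, counted with multiplicity; thus the number of edges between $x$ and $y$ is the number of pairs $(k,g)$ with $-1\le k\le d$, $g\in L_{k,m}$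 and $g$ mapping $x$ to $y$. Let every edge have unit resistance, and let $\bar r(d,m,n)$ be the maximum over all pairs of vertices $x,y$ of the effective resistance between $x$ and $y$ in $\mathcal G(d,m,n)$. **Theorem.** Let $d\ge 0$ and $m\ge 2$. There is a constant $c>0$ depending only on $d$ and $m$ such that - if $d=0$, then $\bar r(0,m,n)\le c\left(\frac{m}{m-1}\right)^n$ for all $n\ge 1$; - if $d\in\{1,2\}$, then $\bar r(d,m,n)\le c\,n^{3-d-\log_m(m-1)}$ for all $n\ge 1$; - if $d=3$ and $m=2$, then $\bar r(3,2,n)\le c\log^2 n$ for all $n\ge 2$; - if $d\ge 4$, or if $d\ge 3$ and $m\ge 3$, then $\bar r(d,m,n)\le c$ for all $n\ge 1$. Moreover, for $d=0$ there is a constant $c'>0$ depending only on $m$ such that $\bar r(0,m,n)\ge c'\left(\frac{m}{m-1}\right)^n$ for all $n\ge 1$. -/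

import Mathlib

open scoped ENNReal

namespace FractalMother

/-! Words over the alphabet `{0, …, m-1}` are lists whose head is the letter that is read first
(written words in the literature have this letter on the right). The vertices of the `m`-ary rooted
tree are all finite words. -/

/-- Apply a permutation of the alphabet to the first letter of a word. -/
def headMap {m : ℕ} (σ : Equiv.Perm (Fin m)) : List (Fin m) → List (Fin m)
  | [] => []
  | x :: u => σ x :: u

/-- The element `σ ∈ Sym(m)` acting on the tree by permuting the first letter. -/
def headPerm {m : ℕ} (σ : Equiv.Perm (Fin m)) : Equiv.Perm (List (Fin m)) where
  toFun := headMap σ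
  invFun := headMap σ⁻¹
  left_inv u := by cases u <;> simp [headMap]
  right_inv u := by cases u <;> simp [headMap]

/-- An automorphism of the first two levels of the `m`-ary tree that fixes `0` and its children,
i.e. an element of `Sym(m) ≀ Sym(m-1)`: a nonzero letter `x` goes to `top x`, and a letter that
directly follows the nonzero letter `x` is permuted by `below x`. (The value `below 0` is never
used.) -/
structure TwoLevel (m : ℕ) where
  top : Equiv.Perm (Fin m)
  below : Fin m → Equiv.Perm (Fin m)
  top_zero : ∀ x : Fin m, x.val = 0 → top x = x

namespace TwoLevel

variable {m : ℕ}

theorem top_symm_zero (s : TwoLevel m) (x : Fin m) (hx : x.val = 0) : s.top.symm x = x := by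
  rw [Equiv.symm_apply_eq]
  exact (s.top_zero x hx).symm

theorem top_ne_zero (s : TwoLevel m) (x : Fin m) (hx : x.val ≠ 0) : (s.top x).val ≠ 0 := by
  intro h
  have h1 : s.top (s.top x) = s.top x := s.top_zero _ h
  have h2 : s.top x = x := s.top.injective h1
  rw [h2] at h
  exact hx h

/-- The inverse automorphism of the first two levels. -/
def inv (s : TwoLevel m) : TwoLevel m where
  top := s.top.symm
  below x := (s.below (s.top.symm x))⁻¹
  top_zero := s.top_symm_zero

end TwoLevel

/-- `lamMap s w u`: if the first `|w|` nonzero letters of `u` agree with `w`, then `s` is applied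
to the next nonzero letter of `u` and the letter that follows it; otherwise `u` is unchanged. -/
def lamMap {m : ℕ} (s : TwoLevel m) : List (Fin m) → List (Fin m) → List (Fin m)
  | _, [] => []
  | [], x :: u =>
      if x.val = 0 then x :: lamMap s [] u else s.top x :: headMap (s.below x) u
  | a :: w, x :: u =>
      if x.val = 0 then x :: lamMap s (a :: w) u
      else if x = a then x :: lamMap s w u
      else x :: u

theorem lamMap_inv_lamMap {m : ℕ} (s : TwoLevel m) (w u : List (Fin m)) :
    lamMap s.inv w (lamMap s w u) = u := by
  induction u generalizing w with
  | nil => simp [lamMap]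
  | cons x u ih =>
    cases w with
    | nil =>
      by_cases hx : x.val = 0
      · simp [lamMap, hx, ih]
      · have h := s.top_ne_zero x hx
        cases u <;> simp [lamMap, hx, h, TwoLevel.inv, headMap]
    | cons a w =>
      by_cases hx : x.val = 0
      · simp [lamMap, hx, ih]
      · by_cases ha : x = a
        · subst ha
          simp [lamMap, hx, ih]
        · simp [lamMap, hx, ha]

theorem lamMap_lamMap_inv {m : ℕ} (s : TwoLevel m) (w u : List (Fin m)) :
    lamMap s w (lamMap s.inv w u) = u := by
  induction u generalizing w with
  | nil => simp [lamMap]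
  | cons x u ih =>
    cases w with
    | nil =>
      by_cases hx : x.val = 0
      · simp [lamMap, hx, ih]
      · have h : (s.top.symm x).val ≠ 0 := s.inv.top_ne_zero x hx
        cases u <;> simp [lamMap, hx, h, TwoLevel.inv, headMap]
    | cons a w =>
      by_cases hx : x.val = 0
      · simp [lamMap, hx, ih]
      · by_cases ha : x = a
        · subst ha
          simp [lamMap, hx, ih]
        · simp [lamMap, hx, ha]

/-- The tree automorphism `λ_{w,s}`. -/
def lam {m : ℕ} (w : List (Fin m)) (s : TwoLevel m) : Equiv.Perm (List (Fin m)) where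
  toFun := lamMap s w
  invFun := lamMap s.inv w
  left_inv := lamMap_inv_lamMap s w
  right_inv := lamMap_lamMap_inv s w

/-- The level subgroups, with the index shifted by one: `levelGroup m 0` is `L_{-1,m} = Sym(m)`
acting on the first letter, and `levelGroup m (k+1)` is `L_{k,m}`, the group generated by all
`λ_{w,s}` with `w` a word of length `k` in the letters `1, …, m-1` and `s ∈ Sym(m) ≀ Sym(m-1)`. -/
def levelGroup (m : ℕ) : ℕ → Subgroup (Equiv.Perm (List (Fin m)))
  | 0 => Subgroup.closure {g | ∃ σ : Equiv.Perm (Fin m), g = headPerm σ}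
  | k + 1 => Subgroup.closure {g | ∃ (w : List (Fin m)) (s : TwoLevel m),
      w.length = k ∧ (∀ a ∈ w, a.val ≠ 0) ∧ g = lam w s}

/-- The fractal mother graph `G(d,m,n)`, given by its edge multiplicities: the Schreier graph of
the action on words of length `n`, with respect to the generating set `⋃_{-1 ≤ k ≤ d} L_{k,m}`
counted with multiplicity. The number of edges between `x` and `y` is the number of pairs `(k, g)`
with `-1 ≤ k ≤ d`, `g ∈ L_{k,m}` and `g x = y`. -/
noncomputable def motherGraph (d m n : ℕ) (x y : List.Vector (Fin m) n) : ℕ :=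
  ∑ j ∈ Finset.range (d + 2), Nat.card {g : levelGroup m j // g.1 x.1 = y.1}

/-- `v` is the voltage of a unit current from `a` to `b`, in the electrical network on the finite
multigraph with edge multiplicities `G` all of whose edges have unit resistance: the net current
out of `x` is `1` at `a`, `-1` at `b` and `0` elsewhere (the net current is `0` everywhere
if `a = b`). -/
def IsUnitVoltage {V : Type*} [Fintype V] [DecidableEq V] (G : V → V → ℕ) (a b : V)
    (v : V → ℝ) : Prop :=
  ∀ x, ∑ y, (G x y : ℝ) * (v x - v y) = (if x = a then 1 else 0) - (if x = b then 1 else 0)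

/-- The effective resistance between `a` and `b`: the voltage difference between `a` and `b` when
a unit current flows from `a` to `b`. It is `∞` if no such current exists (that is, if `a` and `b`
are not connected); otherwise all unit voltages give the same difference. -/
noncomputable def effResistance {V : Type*} [Fintype V] [DecidableEq V] (G : V → V → ℕ)
    (a b : V) : ℝ≥0∞ :=
  ⨅ (v : V → ℝ) (_ : IsUnitVoltage G a b v), ENNReal.ofReal (v a - v b)

/-- The maximal effective resistance between two vertices of `G(d,m,n)`. -/
noncomputable def maxResistance (d m n : ℕ) : ℝ≥0∞ :=
  ⨆ (x : List.Vector (Fin m) n) (y : List.Vector (Fin m) n),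
    effResistance (motherGraph d m n) x y

end FractalMother

/-! By Dirichlet's principle the effective resistance between `x` and `y` is the least `R` such
that `(f x - f y)² ≤ R E(f)` for all functions `f`, where `E(f)` is the energy of `f`. For the
lower bound a single potential is enough.

For the upper bounds, note that the functions `u ↦ f (u ++ w)` for different suffixes `w` of the
same length have their energies on disjoint sets of edges, so that averaging an estimate over `N`
suffixes gains a factor `√N` by the Cauchy–Schwarz inequality. The same holds for the functions
`u ↦ f (0ⁱ a u)` with different nonzero letters `a` or different `i`; here the edges of level `k`
for `u` are edges of level `k + 1` for `0ⁱ a u`. The bounds below are for `√R`.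

* In degree zero, the difference between `f (0ⁿ⁺¹)` and the average of `f` over the words `0ⁿ a`
  with `a ≠ 0`, relative to `√E(f)`, grows at most by the factor `√(m / (m - 1))` from one `n` to
  the next.
* In degree one, `f x` is compared with the average of `f` over the words `0ᴹ a v` with `a ≠ 0`
  and `v` of length about `log_m n`. Resistances of degree zero enter only for words of that
  length, which gives `√n · √(m / (m - 1)) ^ (log_m n)`.
* From one degree to the next, `f x` is compared with the average over the words `0ˡ 0ˢ a 0ᵗ` with
  `a ≠ 0` and `s + 1 + t = 2ⁱ`, for `i = 0, 1, 2, …` in turn. Averaging over the positions of `a`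
  gains `2^(i/2)`, so that a bound `n ^ α` is replaced by the sum of `2 ^ (i (α - 1/2))` over
  `2ⁱ ≤ n`. This is of order `n ^ (α - 1/2)`, `log n` or `1`, for `α` above, at or below `1/2`. -/

open scoped BigOperators

namespace FractalMother

/-! ### Sums over words -/

section Words

variable {α M : Type*} [Fintype α] [AddCommMonoid M]

theorem sum_vector_zero (F : List α → M) : ∑ x : List.Vector α 0, F x.1 = F [] :=
  Fintype.sum_subsingleton (fun x : List.Vector α 0 => F x.1) List.Vector.nil

theorem sum_vector_succ (n : ℕ) (F : List α → M) :
    ∑ x : List.Vector α (n + 1), F x.1 = ∑ a, ∑ u : List.Vector α n, F (a :: u.1) := by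
  rw [← Fintype.sum_prod_type']
  refine Fintype.sum_equiv
    ⟨fun x => (x.head, x.tail), fun p => p.1 ::ᵥ p.2, fun x => by simp, fun p => by simp⟩ _ _
    fun x => ?_
  conv_lhs => rw [← List.Vector.cons_head_tail x]
  rfl

theorem sum_vector_add (n s : ℕ) (F : List α → M) :
    ∑ x : List.Vector α (n + s), F x.1
      = ∑ u : List.Vector α n, ∑ w : List.Vector α s, F (u.1 ++ w.1) := by
  induction n generalizing F with
  | zero =>
    rw [Nat.zero_add, sum_vector_zero fun u => ∑ w : List.Vector α s, F (u ++ w.1)]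
    rfl
  | succ n ih =>
    rw [Nat.add_right_comm, sum_vector_succ,
      sum_vector_succ n fun u => ∑ w : List.Vector α s, F (u ++ w.1)]
    exact Finset.sum_congr rfl fun a _ => ih fun u => F (a :: u)

theorem sum_cons_cons_same_head_le {F : List α → List α → ℝ} (hF : ∀ x y, 0 ≤ F x y) (n : ℕ) :
    ∑ a, ∑ u : List.Vector α n, ∑ v : List.Vector α n, F (a :: u.1) (a :: v.1)
      ≤ ∑ x : List.Vector α (n + 1), ∑ y : List.Vector α (n + 1), F x.1 y.1 := by
  rw [sum_vector_succ n fun x => ∑ y : List.Vector α (n + 1), F x y.1]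
  gcongr with a _ u _
  rw [sum_vector_succ n (F (a :: u.1))]
  exact Finset.single_le_sum (f := fun b => ∑ v : List.Vector α n, F (a :: u.1) (b :: v.1))
    (fun _ _ => Finset.sum_nonneg fun _ _ => hF _ _) (Finset.mem_univ a)

theorem sum_cons_cons_same_tail_le {F : List α → List α → ℝ} (hF : ∀ x y, 0 ≤ F x y) (n : ℕ) :
    ∑ u : List.Vector α n, ∑ a, ∑ b, F (a :: u.1) (b :: u.1)
      ≤ ∑ x : List.Vector α (n + 1), ∑ y : List.Vector α (n + 1), F x.1 y.1 := by
  rw [sum_vector_succ n fun x => ∑ y : List.Vector α (n + 1), F x y.1, Finset.sum_comm]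
  gcongr with a _ u _
  rw [sum_vector_succ n (F (a :: u.1))]
  gcongr with b
  exact Finset.single_le_sum (f := fun v : List.Vector α n => F (a :: u.1) (b :: v.1))
    (fun _ _ => hF _ _) (Finset.mem_univ u)

end Words

/-! ### Averages and the Cauchy–Schwarz inequality -/

theorem sqrt_mul_add_sqrt_mul_le {a b x y : ℝ} (ha : 0 ≤ a) (hb : 0 ≤ b) (hx : 0 ≤ x)
    (hy : 0 ≤ y) : √a * √x + √b * √y ≤ √(a + b) * √(x + y) := by
  simpa [Fin.sum_univ_two] using Real.sum_sqrt_mul_sqrt_le Finset.univ (f := ![a, b])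
    (g := ![x, y]) (by simp [Fin.forall_fin_two, ha, hb]) (by simp [Fin.forall_fin_two, hx, hy])

section Averages

variable {ι κ : Type*} [Fintype ι] [Nonempty ι]

theorem abs_expect_le_of_forall_le {g : ι → ℝ} {c : ℝ} (h : ∀ i, |g i| ≤ c) : |𝔼 i, g i| ≤ c :=
  (Finset.abs_expect_le _ _).trans (Finset.expect_le Finset.univ_nonempty fun i _ => h i)

theorem abs_sub_expect_le {x c : ℝ} {g : ι → ℝ} (h : ∀ i, |x - g i| ≤ c) :
    |x - 𝔼 i, g i| ≤ c := by
  rw [← Fintype.expect_const (ι := ι) x, ← Finset.expect_sub_distrib]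
  exact abs_expect_le_of_forall_le h

theorem abs_expect_sub_expect_le [Fintype κ] [Nonempty κ] {g : ι → ℝ} {h : κ → ℝ} {c : ℝ}
    (H : ∀ i j, |g i - h j| ≤ c) : |𝔼 i, g i - 𝔼 j, h j| ≤ c :=
  abs_sub_expect_le fun j => by
    rw [abs_sub_comm]
    exact abs_sub_expect_le fun i => (abs_sub_comm _ _).trans_le (H i j)

theorem abs_expect_le_div_sqrt_card {g e : ι → ℝ} {K E : ℝ} (hK : 0 ≤ K) (he : ∀ i, 0 ≤ e i)
    (h : ∀ i, |g i| ≤ K * √(e i)) (hE : ∑ i, e i ≤ E) :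
    |𝔼 i, g i| ≤ K / √(Fintype.card ι) * √E := by
  have hsum : ∑ i, √(e i) ≤ √(Fintype.card ι) * √(∑ i, e i) := by
    simpa using Real.sum_sqrt_mul_sqrt_le Finset.univ (f := fun _ : ι => 1) (by simp) he
  have hcard : (0 : ℝ) < Fintype.card ι := by exact_mod_cast Fintype.card_pos
  rw [Fintype.expect_eq_sum_div_card, abs_div, Nat.abs_cast, div_le_iff₀ hcard]
  calc |∑ i, g i| ≤ ∑ i, |g i| := Finset.abs_sum_le_sum_abs _ _
    _ ≤ ∑ i, K * √(e i) := Finset.sum_le_sum fun i _ => h i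
    _ = K * ∑ i, √(e i) := (Finset.mul_sum _ _ _).symm
    _ ≤ K * (√(Fintype.card ι) * √E) := by grw [hsum, hE]
    _ = K * (Fintype.card ι / √(Fintype.card ι) * √E) := by rw [Real.div_sqrt]
    _ = K / √(Fintype.card ι) * √E * Fintype.card ι := by ring

theorem abs_expect_le_mul_sqrt {g e : ι → ℝ} {K E : ℝ} (hK : 0 ≤ K) (he : ∀ i, 0 ≤ e i)
    (h : ∀ i, |g i| ≤ K * √(e i)) (hE : ∑ i, e i ≤ E) : |𝔼 i, g i| ≤ K * √E := by
  have hcard : 1 ≤ √(Fintype.card ι : ℝ) := by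
    rw [Real.one_le_sqrt]
    exact_mod_cast Fintype.card_pos
  calc |𝔼 i, g i| ≤ K / √(Fintype.card ι) * √E := abs_expect_le_div_sqrt_card hK he h hE
    _ ≤ K * √E := by gcongr; exact div_le_self hK hcard

end Averages

/-! ### The level groups -/

namespace TwoLevel

variable {m : ℕ}

/-- The trivial automorphism of the first two levels. -/
def one (m : ℕ) : TwoLevel m := ⟨1, fun _ => 1, fun _ _ => rfl⟩

/-- The product in `Sym(m) ≀ Sym(m-1)`; as for permutations, the right factor acts first. -/
def mul (s t : TwoLevel m) : TwoLevel m where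
  top := s.top * t.top
  below x := s.below (t.top x) * t.below x
  top_zero x hx := by rw [Equiv.Perm.mul_apply, t.top_zero x hx, s.top_zero x hx]

instance : Finite (TwoLevel m) :=
  Finite.of_injective (fun s => (s.top, s.below)) fun s t h => by
    cases s; cases t; simp_all

end TwoLevel

section Perms

variable {m : ℕ}

theorem headPerm_one : headPerm (1 : Equiv.Perm (Fin m)) = 1 := by
  ext1 u
  cases u <;> rfl

theorem headPerm_mul (σ τ : Equiv.Perm (Fin m)) :
    headPerm (σ * τ) = headPerm σ * headPerm τ := by
  ext1 u
  cases u <;> rfl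

theorem lam_nil_one : lam [] (TwoLevel.one m) = 1 := by
  ext1 u
  induction u with
  | nil => rfl
  | cons x u ih =>
    change lamMap _ _ _ = _ at ih
    cases u <;> simp_all [lam, lamMap, TwoLevel.one, headMap]

theorem lam_nil_mul (s t : TwoLevel m) : lam [] (s.mul t) = lam [] s * lam [] t := by
  ext1 u
  induction u with
  | nil => rfl
  | cons x u ih =>
    change lamMap _ _ _ = lamMap _ _ (lamMap _ _ _) at ih
    by_cases hx : x.val = 0
    · simp [lam, lamMap, hx, ih]
    · have h := t.top_ne_zero x hx
      cases u <;> simp [lam, lamMap, hx, h, TwoLevel.mul, headMap]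

theorem exists_eq_headPerm_of_mem_levelGroup {g : Equiv.Perm (List (Fin m))}
    (hg : g ∈ levelGroup m 0) : ∃ σ, g = headPerm σ := by
  induction hg using Subgroup.closure_induction with
  | mem _ hg => exact hg
  | one => exact ⟨1, headPerm_one.symm⟩
  | mul g h _ _ hg hh =>
    obtain ⟨σ, rfl⟩ := hg
    obtain ⟨τ, rfl⟩ := hh
    exact ⟨σ * τ, (headPerm_mul σ τ).symm⟩
  | inv g _ hg =>
    obtain ⟨σ, rfl⟩ := hg
    exact ⟨σ⁻¹, inv_eq_of_mul_eq_one_right (by rw [← headPerm_mul, mul_inv_cancel, headPerm_one])⟩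

theorem exists_eq_lam_nil_of_mem_levelGroup {g : Equiv.Perm (List (Fin m))}
    (hg : g ∈ levelGroup m 1) : ∃ s, g = lam [] s := by
  induction hg using Subgroup.closure_induction with
  | mem g hg =>
    obtain ⟨w, s, hw, -, rfl⟩ := hg
    exact ⟨s, by rw [List.length_eq_zero_iff.1 hw]⟩
  | one => exact ⟨TwoLevel.one m, lam_nil_one.symm⟩
  | mul g h _ _ hg hh =>
    obtain ⟨s, rfl⟩ := hg
    obtain ⟨t, rfl⟩ := hh
    exact ⟨s.mul t, (lam_nil_mul s t).symm⟩
  | inv g _ hg =>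
    obtain ⟨s, rfl⟩ := hg
    exact ⟨s.inv, Equiv.ext fun _ => rfl⟩

end Perms

/-- The pairs of permutations intertwined by `f`, as a subgroup. With `f = (x :: ·)` the pair
`(g, h)` says that `h` fixes the letter `x` and has section `g` there. -/
def semiconjPairs {α β : Type*} (f : α → β) : Subgroup (Equiv.Perm α × Equiv.Perm β) where
  carrier := {p | Function.Semiconj f p.1 p.2}
  one_mem' _ := rfl
  mul_mem' hp hp' := hp.comp_right hp'
  inv_mem' {p} hp := hp.inverses_right p.1.right_inv p.2.left_inv

/-- Words over the alphabet with the letter `0` and the `q` nonzero letters `Fin.succ a`. -/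
abbrev Word (q : ℕ) := List (Fin (q + 1))

section Sections

variable {q j : ℕ}

theorem lam_zero_cons (w : Word q) (s : TwoLevel (q + 1)) (u : Word q) :
    lam w s (0 :: u) = 0 :: lam w s u := by
  cases w <;> simp [lam, lamMap]

theorem lam_cons_self (a : Fin q) (w : Word q) (s : TwoLevel (q + 1))
    (u : Word q) : lam (a.succ :: w) s (a.succ :: u) = a.succ :: lam w s u := by
  simp [lam, lamMap]

theorem lam_cons_of_ne {a : Fin q} {x : Fin (q + 1)} (hx : a.succ ≠ x) (w : Word q)
    (s : TwoLevel (q + 1)) (u : Word q) :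
    lam (x :: w) s (a.succ :: u) = a.succ :: u := by
  simp [lam, lamMap, hx]

theorem apply_nil_of_mem_levelGroup {g : Equiv.Perm (Word q)}
    (hg : g ∈ levelGroup (q + 1) (j + 1)) : g [] = [] := by
  have hle : levelGroup (q + 1) (j + 1) ≤ MulAction.stabilizer _ ([] : Word q) := by
    refine (Subgroup.closure_le _).2 ?_
    rintro _ ⟨w, s, -, -, rfl⟩
    simp [lam, lamMap]
  exact hle hg

theorem apply_zero_cons_of_mem_levelGroup {g : Equiv.Perm (Word q)}
    (hg : g ∈ levelGroup (q + 1) (j + 1)) (u : Word q) : g (0 :: u) = 0 :: g u := by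
  have hle : levelGroup (q + 1) (j + 1)
      ≤ (semiconjPairs (0 :: ·)).comap ((MonoidHom.id _).prod (MonoidHom.id _)) := by
    refine (Subgroup.closure_le _).2 ?_
    rintro _ ⟨w, s, -, -, rfl⟩ u
    exact (lam_zero_cons w s u).symm
  exact (hle hg u).symm

theorem exists_apply_succ_cons_of_mem_levelGroup {g : Equiv.Perm (Word q)}
    (hg : g ∈ levelGroup (q + 1) (j + 2)) (a : Fin q) :
    ∃ h ∈ levelGroup (q + 1) (j + 1), ∀ u, g (a.succ :: u) = a.succ :: h u := by
  have hle : levelGroup (q + 1) (j + 2) ≤ (semiconjPairs (a.succ :: ·) ⊓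
      (levelGroup (q + 1) (j + 1)).prod ⊤).map (MonoidHom.snd _ _) := by
    refine (Subgroup.closure_le _).2 ?_
    rintro _ ⟨w, s, hw, hw0, rfl⟩
    obtain ⟨x, w, rfl⟩ := List.exists_cons_of_length_eq_add_one hw
    simp only [List.length_cons, Nat.add_right_cancel_iff, List.forall_mem_cons] at hw hw0
    obtain rfl | hx := eq_or_ne a.succ x
    · exact ⟨(lam w s, lam _ s), ⟨fun u => (lam_cons_self a w s u).symm,
        Subgroup.subset_closure ⟨w, s, hw, hw0.2, rfl⟩, trivial⟩, rfl⟩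
    · exact ⟨(1, lam _ s), ⟨fun u => (lam_cons_of_ne hx w s u).symm, one_mem _, trivial⟩, rfl⟩
  obtain ⟨⟨h, _⟩, ⟨hsection, hh, -⟩, rfl⟩ := hle hg
  exact ⟨h, hh, fun u => (hsection u).symm⟩

theorem exists_mem_levelGroup_apply_succ_cons {g : Equiv.Perm (Word q)}
    (hg : g ∈ levelGroup (q + 1) j) (a : Fin q) :
    ∃ h ∈ levelGroup (q + 1) (j + 1), ∀ u, h (a.succ :: u) = a.succ :: g u := by
  have hle : levelGroup (q + 1) j ≤ (semiconjPairs (a.succ :: ·) ⊓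
      (⊤ : Subgroup _).prod (levelGroup (q + 1) (j + 1))).map (MonoidHom.fst _ _) := by
    cases j with
    | zero =>
      refine (Subgroup.closure_le _).2 ?_
      rintro _ ⟨σ, rfl⟩
      refine ⟨(headPerm σ, lam [] ⟨1, fun _ => σ, fun _ _ => rfl⟩), ⟨fun u => ?_, trivial,
        Subgroup.subset_closure ⟨[], _, rfl, by simp, rfl⟩⟩, rfl⟩
      simp [lam, lamMap, headPerm]
    | succ j =>
      refine (Subgroup.closure_le _).2 ?_
      rintro _ ⟨w, s, hw, hw0, rfl⟩
      exact ⟨(lam w s, lam (a.succ :: w) s), ⟨fun u => (lam_cons_self a w s u).symm, trivial,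
        Subgroup.subset_closure ⟨a.succ :: w, s, by simp [hw], by simpa using hw0, rfl⟩⟩, rfl⟩
  obtain ⟨⟨_, h⟩, ⟨hsection, -, hh⟩, rfl⟩ := hle hg
  exact ⟨h, hh, fun u => (hsection u).symm⟩

instance finite_levelGroup : Finite (levelGroup (q + 1) j) := by
  induction j using Nat.twoStepInduction with
  | zero =>
    exact ((Set.finite_range headPerm).subset fun g hg =>
      (exists_eq_headPerm_of_mem_levelGroup hg).imp fun _ h => h.symm).to_subtype
  | one =>
    exact ((Set.finite_range (lam [])).subset fun g hg =>
      (exists_eq_lam_nil_of_mem_levelGroup hg).imp fun _ h => h.symm).to_subtype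
  | more j _ _ =>
    choose sec hsec_mem hsec using fun g : levelGroup (q + 1) (j + 2) =>
      exists_apply_succ_cons_of_mem_levelGroup g.2
    refine Finite.of_injective (β := Fin q → levelGroup (q + 1) (j + 1))
      (fun g a => ⟨sec g a, hsec_mem g a⟩) fun g h hgh => Subtype.ext (Equiv.ext fun u => ?_)
    induction u with
    | nil => rw [apply_nil_of_mem_levelGroup g.2, apply_nil_of_mem_levelGroup h.2]
    | cons x u ih =>
      cases x using Fin.cases with
      | zero =>
        rw [apply_zero_cons_of_mem_levelGroup g.2, apply_zero_cons_of_mem_levelGroup h.2, ih]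
      | succ a =>
        rw [hsec, hsec, show sec g a = sec h a from congr_arg Subtype.val (congrFun hgh a)]

end Sections

/-- The number of elements of the `j`-th level group (in the shifted indexing of `levelGroup`) that
map the word `x` to the word `y`. -/
noncomputable def stepCount (m j : ℕ) (x y : List (Fin m)) : ℕ :=
  Nat.card {g : levelGroup m j // g.1 x = y}

theorem stepCount_comm (m j : ℕ) (x y : List (Fin m)) : stepCount m j x y = stepCount m j y x :=
  Nat.card_congr <| (Equiv.inv _).subtypeEquiv fun g => by
    change g.1 x = y ↔ g.1⁻¹ y = x
    rw [Equiv.Perm.inv_eq_iff_eq, eq_comm]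

theorem motherGraph_comm (d m n : ℕ) (x y : List.Vector (Fin m) n) :
    motherGraph d m n x y = motherGraph d m n y x :=
  Finset.sum_congr rfl fun j _ => stepCount_comm m j x.1 y.1

section StepCount

variable {q j : ℕ}

theorem one_le_stepCount_zero_cons (x y : Fin (q + 1)) (u : Word q) :
    1 ≤ stepCount (q + 1) 0 (x :: u) (y :: u) := by
  have hmem : headPerm (Equiv.swap x y) ∈ levelGroup (q + 1) 0 := Subgroup.subset_closure ⟨_, rfl⟩
  have : Nonempty {g : levelGroup (q + 1) 0 // g.1 (x :: u) = y :: u} :=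
    ⟨⟨_, hmem⟩, by simp [headPerm, headMap]⟩
  exact Finite.card_pos

theorem stepCount_le_zero_cons (u v : Word q) :
    stepCount (q + 1) (j + 1) u v ≤ stepCount (q + 1) (j + 1) (0 :: u) (0 :: v) :=
  Nat.card_le_card_of_injective
    (fun g => ⟨g.1, by rw [apply_zero_cons_of_mem_levelGroup g.1.2, g.2]⟩)
    fun _ _ h => Subtype.ext (congr_arg (fun g => g.1) h)

theorem stepCount_le_succ_cons (a : Fin q) (u v : Word q) :
    stepCount (q + 1) j u v ≤ stepCount (q + 1) (j + 1) (a.succ :: u) (a.succ :: v) := by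
  choose lift hlift_mem hlift using fun g : levelGroup (q + 1) j =>
    exists_mem_levelGroup_apply_succ_cons g.2 a
  refine Nat.card_le_card_of_injective
    (fun g => ⟨⟨lift g.1, hlift_mem g.1⟩, by rw [hlift, g.2]⟩) fun g h hgh => ?_
  have hlift_eq : lift g.1 = lift h.1 := congr_arg (fun g => g.1.1) hgh
  refine Subtype.ext (Subtype.ext (Equiv.ext fun u => ?_))
  simpa [hlift] using congr_arg (· (a.succ :: u)) hlift_eq

end StepCount

/-! ### Energies -/

section Energy

variable {q : ℕ}

/-- The energy of `f : Word q → ℝ` on words of length `n` along some of the edges that come from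
the `j`-th level group, described recursively: the edges of level `0` change the first letter, those
of level `j + 1` skip a zero, or skip a nonzero letter and continue at level `j`. -/
noncomputable def levelEnergy : ℕ → ℕ → (Word q → ℝ) → ℝ
  | _, 0, _ => 0
  | 0, n + 1, f => ∑ u : List.Vector (Fin (q + 1)) n, ∑ x, ∑ y, (f (x :: u.1) - f (y :: u.1)) ^ 2
  | j + 1, n + 1, f => levelEnergy (j + 1) n (fun u => f (0 :: u))
      + ∑ a : Fin q, levelEnergy j n (fun u => f (a.succ :: u))

/-- The energy of `f` on words of length `n` along the edges of the first `K` levels. -/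
noncomputable def energy (K n : ℕ) (f : Word q → ℝ) : ℝ := ∑ j ∈ Finset.range K, levelEnergy j n f

theorem levelEnergy_nonneg (j n : ℕ) (f : Word q → ℝ) : 0 ≤ levelEnergy j n f := by
  induction n generalizing j f with
  | zero => simp [levelEnergy]
  | succ n ih =>
    cases j with
    | zero => exact Finset.sum_nonneg fun _ _ => by positivity
    | succ j => exact add_nonneg (ih _ _) (Finset.sum_nonneg fun _ _ => ih _ _)

theorem energy_nonneg (K n : ℕ) (f : Word q → ℝ) : 0 ≤ energy K n f :=
  Finset.sum_nonneg fun _ _ => levelEnergy_nonneg _ _ _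

theorem energy_mono {K L : ℕ} (h : K ≤ L) (n : ℕ) (f : Word q → ℝ) : energy K n f ≤ energy L n f :=
  Finset.sum_le_sum_of_subset_of_nonneg (Finset.range_subset_range.2 h)
    fun _ _ _ => levelEnergy_nonneg _ _ _

theorem abs_sub_cons_le {K n : ℕ} (hK : 1 ≤ K) {u : Word q} (hu : u.length = n)
    (x y : Fin (q + 1)) (f : Word q → ℝ) :
    |f (x :: u) - f (y :: u)| ≤ √(energy K (n + 1) f) := by
  refine Real.abs_le_sqrt ?_
  calc (f (x :: u) - f (y :: u)) ^ 2
      ≤ ∑ y, (f (x :: u) - f (y :: u)) ^ 2 :=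
        Finset.single_le_sum (f := fun y => (f (x :: u) - f (y :: u)) ^ 2)
          (fun _ _ => sq_nonneg _) (Finset.mem_univ y)
    _ ≤ ∑ x, ∑ y, (f (x :: u) - f (y :: u)) ^ 2 :=
        Finset.single_le_sum (f := fun x => ∑ y, (f (x :: u) - f (y :: u)) ^ 2)
          (fun _ _ => by positivity) (Finset.mem_univ x)
    _ ≤ levelEnergy 0 (n + 1) f :=
        Finset.single_le_sum (f := fun u : List.Vector (Fin (q + 1)) n =>
          ∑ x, ∑ y, (f (x :: u.1) - f (y :: u.1)) ^ 2)
          (fun _ _ => by positivity) (Finset.mem_univ ⟨u, hu⟩)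
    _ ≤ energy K (n + 1) f :=
        Finset.single_le_sum (f := fun j => levelEnergy j (n + 1) f)
          (fun _ _ => levelEnergy_nonneg _ _ _) (Finset.mem_range.2 hK)

theorem sum_levelEnergy_vector_le (j n s : ℕ) (f : Word q → ℝ) :
    ∑ w : List.Vector (Fin (q + 1)) s, levelEnergy j n (fun u => f (u ++ w.1))
      ≤ levelEnergy j (n + s) f := by
  induction n generalizing j f with
  | zero => simpa [levelEnergy] using levelEnergy_nonneg _ _ _
  | succ n ih =>
    rw [Nat.add_right_comm]
    cases j with
    | zero =>
      refine (Finset.sum_comm.trans (Eq.symm ?_)).le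
      exact sum_vector_add n s fun u => ∑ x, ∑ y, (f (x :: u) - f (y :: u)) ^ 2
    | succ j =>
      simp only [levelEnergy, List.cons_append, Finset.sum_add_distrib]
      rw [Finset.sum_comm (s := Finset.univ (α := List.Vector (Fin (q + 1)) s))]
      exact add_le_add (ih _ fun u => f (0 :: u))
        (Finset.sum_le_sum fun a _ => ih _ fun u => f (a.succ :: u))

theorem sum_energy_append_le {ι : Type*} [Fintype ι] (K n s : ℕ) {w : ι → Word q}
    (hw : Function.Injective w) (hs : ∀ i, (w i).length = s) (f : Word q → ℝ) :
    ∑ i, energy K n (fun u => f (u ++ w i)) ≤ energy K (n + s) f := by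
  let w' : ι ↪ List.Vector (Fin (q + 1)) s :=
    ⟨fun i => ⟨w i, hs i⟩, fun _ _ h => hw (congr_arg Subtype.val h)⟩
  calc ∑ i, energy K n (fun u => f (u ++ w i))
      = ∑ v ∈ Finset.univ.map w', energy K n (fun u => f (u ++ v.1)) :=
        (Finset.sum_map _ w' fun v => energy K n (fun u => f (u ++ v.1))).symm
    _ ≤ ∑ v : List.Vector (Fin (q + 1)) s, energy K n (fun u => f (u ++ v.1)) :=
        Finset.sum_le_univ_sum_of_nonneg fun _ => energy_nonneg _ _ _
    _ = ∑ j ∈ Finset.range K, ∑ v : List.Vector (Fin (q + 1)) s,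
          levelEnergy j n (fun u => f (u ++ v.1)) := Finset.sum_comm
    _ ≤ energy K (n + s) f := Finset.sum_le_sum fun j _ => sum_levelEnergy_vector_le j n s f

theorem energy_append_le (K n : ℕ) (w : Word q) (f : Word q → ℝ) :
    energy K n (fun u => f (u ++ w)) ≤ energy K (n + w.length) f := by
  simpa using sum_energy_append_le K n w.length (w := fun _ : Unit => w)
    (Function.injective_of_subsingleton _) (fun _ => rfl) f

theorem energy_concat_add_le (K n : ℕ) (c : Fin (q + 1)) (f : Word q → ℝ) :
    energy K n (fun u => f (u ++ [c]))
      + ∑ i : Fin q, energy K n (fun u => f (u ++ [c.succAbove i])) ≤ energy K (n + 1) f := by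
  rw [← Fin.sum_univ_succAbove (fun c => energy K n (fun u => f (u ++ [c]))) c]
  exact sum_energy_append_le K n 1 List.singleton_injective (fun _ => rfl) f

/-- The word `0ⁱ a u` with `a` a nonzero letter. -/
def zerosCons (i : ℕ) (a : Fin q) (u : Word q) : Word q := List.replicate i 0 ++ a.succ :: u

theorem zerosCons_append (i : ℕ) (a : Fin q) (u w : Word q) :
    zerosCons i a u ++ w = zerosCons i a (u ++ w) := by simp [zerosCons]

theorem length_zerosCons (i : ℕ) (a : Fin q) (u : Word q) :
    (zerosCons i a u).length = i + 1 + u.length := by simp [zerosCons]; omega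

/-- The energy along the edges that lie behind one of the prefixes `0ⁱ a` with `i < N` and `a ≠ 0`
and are of the first `K` levels after that prefix. -/
noncomputable def prefixEnergy (K N n : ℕ) (f : Word q → ℝ) : ℝ :=
  ∑ i ∈ Finset.range N, ∑ a : Fin q, energy K (n - (i + 1)) (fun u => f (zerosCons i a u))

theorem prefixEnergy_nonneg (K N n : ℕ) (f : Word q → ℝ) : 0 ≤ prefixEnergy K N n f :=
  Finset.sum_nonneg fun _ _ => Finset.sum_nonneg fun _ _ => energy_nonneg _ _ _

theorem sum_levelEnergy_zerosCons_le (j : ℕ) {n N : ℕ} (hN : N ≤ n) (f : Word q → ℝ) :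
    ∑ i ∈ Finset.range N, ∑ a : Fin q, levelEnergy j (n - (i + 1)) (fun u => f (zerosCons i a u))
      ≤ levelEnergy (j + 1) n f := by
  induction N generalizing n f with
  | zero => simpa using levelEnergy_nonneg _ _ _
  | succ N ih =>
    obtain ⟨n, rfl⟩ := Nat.exists_eq_add_of_le' (Nat.one_le_of_lt hN)
    rw [Finset.sum_range_succ']
    simp only [Nat.add_sub_add_right]
    exact add_le_add_left (ih (Nat.le_of_succ_le_succ hN) fun u => f (0 :: u)) _

theorem prefixEnergy_le (K : ℕ) {n N : ℕ} (hN : N ≤ n) (f : Word q → ℝ) :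
    prefixEnergy K N n f ≤ energy (K + 1) n f := by
  calc prefixEnergy K N n f
      = ∑ j ∈ Finset.range K, ∑ i ∈ Finset.range N, ∑ a : Fin q,
          levelEnergy j (n - (i + 1)) (fun u => f (zerosCons i a u)) := by
        simp_rw [prefixEnergy, energy, Finset.sum_comm (s := Finset.univ (α := Fin q))]
        exact Finset.sum_comm
    _ ≤ ∑ j ∈ Finset.range K, levelEnergy (j + 1) n f :=
        Finset.sum_le_sum fun j _ => sum_levelEnergy_zerosCons_le j hN f
    _ ≤ energy (K + 1) n f := by
        rw [energy, Finset.sum_range_succ']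
        exact le_add_of_nonneg_right (levelEnergy_nonneg _ _ _)

theorem sum_energy_zerosCons_le (K i n : ℕ) (f : Word q → ℝ) :
    ∑ a : Fin q, energy K n (fun u => f (zerosCons i a u)) ≤ energy (K + 1) (i + 1 + n) f := by
  refine le_trans ?_ (prefixEnergy_le K (Nat.le_add_right (i + 1) n) f)
  rw [prefixEnergy, Finset.sum_range_succ, Nat.add_sub_cancel_left]
  exact le_add_of_nonneg_left (prefixEnergy_nonneg K i _ f)

/-- The diameter bound for the effective resistance on words of length `n` along the edges of the
first `K` levels, in dual form: `f` varies by at most `ρ` times the square root of its energy. -/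
def ResBound (q K n : ℕ) (ρ : ℝ) : Prop :=
  ∀ (f : Word q → ℝ) (x y : Word q), x.length = n → y.length = n →
    |f x - f y| ≤ ρ * √(energy K n f)

theorem ResBound.mono {K L n : ℕ} {ρ σ : ℝ} (h : ResBound q K n ρ) (hKL : K ≤ L) (hρ : ρ ≤ σ)
    (hσ : 0 ≤ σ) : ResBound q L n σ := fun f x y hx hy => by
  grw [h f x y hx hy, hρ, energy_mono hKL]

theorem resBound_length_zero (K : ℕ) {ρ : ℝ} (hρ : 0 ≤ ρ) : ResBound q K 0 ρ :=
  fun f x y hx hy => by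
    rw [List.length_eq_zero_iff.1 hx, List.length_eq_zero_iff.1 hy, sub_self, abs_zero]
    positivity

end Energy

/-! ### Degree zero -/

section DegreeZero

variable {q : ℕ}

/-- The square of the growth rate of the resistance bound of degree zero. -/
noncomputable def growth (q : ℕ) : ℝ := ((q : ℝ) + 1) / q

/-- The difference between the value of `f` at `0ⁿ⁺¹` and its average over the words `0ⁿa`
with `a ≠ 0`. -/
noncomputable def cornerGap (n : ℕ) (f : Word q → ℝ) : ℝ :=
  f (List.replicate (n + 1) 0) - 𝔼 a : Fin q, f (zerosCons n a [])

theorem cornerGap_succ (n : ℕ) (f : Word q → ℝ) :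
    cornerGap (n + 1) f = cornerGap n (fun u => f (u ++ [0]))
      + 𝔼 a, cornerGap 0 (fun u => f (zerosCons n a u))
      - 𝔼 a : Fin q, cornerGap n (fun u => f (u ++ [a.succ])) := by
  simp only [cornerGap, Finset.expect_sub_distrib]
  rw [Finset.expect_comm]
  simp [zerosCons, List.replicate_succ', List.append_assoc]

theorem replicate_append_eq (n : ℕ) (c : Fin (q + 1)) (f : Word q → ℝ) :
    f (List.replicate (n + 1) 0 ++ [c])
      = cornerGap n (fun u => f (u ++ [c])) + 𝔼 a, f (zerosCons n a [c]) := by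
  simp [cornerGap, zerosCons]

variable [NeZero q]

theorem one_add_inv_eq_growth : 1 + 1 / (q : ℝ) = growth q := by
  have : (q : ℝ) ≠ 0 := NeZero.ne _
  rw [growth]
  field_simp

theorem one_lt_growth : 1 < growth q := by
  have : (0 : ℝ) < q := Nat.cast_pos.2 (NeZero.pos q)
  rw [← one_add_inv_eq_growth]
  simpa

theorem one_lt_sqrt_growth : 1 < √(growth q) := Real.lt_sqrt_of_sq_lt (by simpa using one_lt_growth)

theorem abs_cornerGap_zero_le (f : Word q → ℝ) : |cornerGap 0 f| ≤ √(energy 1 1 f) :=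
  abs_sub_expect_le fun a => abs_sub_cons_le le_rfl rfl 0 a.succ f

theorem abs_expect_cornerGap_zero_le (n : ℕ) (f : Word q → ℝ) :
    |𝔼 a, cornerGap 0 (fun u => f (zerosCons n a u))| ≤ √(energy 2 (n + 1 + 1) f) := by
  rw [← one_mul √_]
  exact abs_expect_le_mul_sqrt zero_le_one (fun a => energy_nonneg _ _ _)
    (fun a => (abs_cornerGap_zero_le _).trans_eq (one_mul _).symm) (sum_energy_zerosCons_le 1 n 1 f)

theorem abs_cornerGap_le (n : ℕ) (f : Word q → ℝ) :
    |cornerGap n f| ≤ (∑ i ∈ Finset.range (n + 1), √(growth q) ^ i) * √(energy 2 (n + 1) f) := by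
  induction n generalizing f with
  | zero =>
    have h := abs_cornerGap_zero_le f
    grw [energy_mono one_le_two] at h
    simpa using h
  | succ n ih =>
    set G : ℝ := ∑ i ∈ Finset.range (n + 1), √(growth q) ^ i
    have hG : 0 ≤ G := Finset.sum_nonneg fun i _ => by positivity
    set E₀ := energy 2 (n + 1) fun u => f (u ++ [0])
    set E₁ := ∑ a : Fin q, energy 2 (n + 1) fun u => f (u ++ [a.succ])
    have hE : E₀ + E₁ ≤ energy 2 (n + 1 + 1) f := by
      simpa using energy_concat_add_le 2 (n + 1) 0 f
    have hsuffix : |𝔼 a : Fin q, cornerGap n (fun u => f (u ++ [a.succ]))| ≤ G / √q * √E₁ := by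
      simpa using abs_expect_le_div_sqrt_card hG (fun a => energy_nonneg _ _ _)
        (fun a : Fin q => ih fun u => f (u ++ [a.succ])) le_rfl
    have hsqrt : √E₀ + 1 / √q * √E₁ ≤ √(growth q) * √(energy 2 (n + 1 + 1) f) := by
      rw [← one_add_inv_eq_growth]
      grw [← hE]
      simpa using sqrt_mul_add_sqrt_mul_le zero_le_one (one_div_nonneg.2 (Nat.cast_nonneg q))
        (energy_nonneg 2 (n + 1) fun u => f (u ++ [0]))
        (Finset.sum_nonneg fun a _ => energy_nonneg 2 (n + 1) fun u => f (u ++ [Fin.succ a]))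
    calc |cornerGap (n + 1) f|
        ≤ G * √E₀ + √(energy 2 (n + 1 + 1) f) + G / √q * √E₁ := by
          rw [cornerGap_succ]
          grw [abs_sub, abs_add_le, ih, abs_expect_cornerGap_zero_le, hsuffix]
      _ = G * (√E₀ + 1 / √q * √E₁) + √(energy 2 (n + 1 + 1) f) := by ring
      _ ≤ G * (√(growth q) * √(energy 2 (n + 1 + 1) f)) + √(energy 2 (n + 1 + 1) f) := by
          grw [hsqrt]
      _ = _ := by rw [geom_sum_succ]; ring

theorem abs_sub_replicate_append_le (n : ℕ) (c c' : Fin (q + 1)) (f : Word q → ℝ) :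
    |f (List.replicate n 0 ++ [c]) - f (List.replicate n 0 ++ [c'])|
      ≤ (2 * ∑ i ∈ Finset.range n, √(growth q) ^ i + 1) * √(energy 2 (n + 1) f) := by
  cases n with
  | zero => simpa using abs_sub_cons_le (n := 0) one_le_two rfl c c' f
  | succ n =>
    have hcorner (c : Fin (q + 1)) : |cornerGap n fun u => f (u ++ [c])|
        ≤ (∑ i ∈ Finset.range (n + 1), √(growth q) ^ i) * √(energy 2 (n + 1 + 1) f) := by
      grw [abs_cornerGap_le, energy_append_le]
      rfl
    have hchange : |𝔼 a, (f (zerosCons n a [c]) - f (zerosCons n a [c']))|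
        ≤ √(energy 2 (n + 1 + 1) f) := by
      rw [← one_mul √_]
      exact abs_expect_le_mul_sqrt zero_le_one (fun a => energy_nonneg _ _ _) (fun a =>
        (abs_sub_cons_le le_rfl rfl c c' fun u => f (zerosCons n a u)).trans_eq (one_mul _).symm)
        (sum_energy_zerosCons_le 1 n 1 f)
    rw [replicate_append_eq n c f, replicate_append_eq n c' f, add_sub_add_comm,
      ← Finset.expect_sub_distrib]
    grw [abs_add_le, abs_sub, hcorner, hcorner, hchange]
    exact (by ring : _ = _).le

theorem abs_sub_replicate_le {n : ℕ} {x : Word q} (hx : x.length = n) (f : Word q → ℝ) :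
    |f x - f (List.replicate n 0)|
      ≤ (∑ k ∈ Finset.range n, (2 * ∑ i ∈ Finset.range k, √(growth q) ^ i + 1))
        * √(energy 2 n f) := by
  induction n generalizing x f with
  | zero => simp [List.length_eq_zero_iff.1 hx]
  | succ n ih =>
    obtain ⟨u, c, rfl⟩ := (List.eq_nil_or_concat' x).resolve_left (by rintro rfl; simp at hx)
    have hu : u.length = n := by simpa using hx
    rw [List.replicate_succ', Finset.sum_range_succ, add_mul]
    refine (abs_sub_le _ (f (List.replicate n 0 ++ [c])) _).trans (add_le_add ?_ ?_)
    · grw [ih hu fun u => f (u ++ [c]), energy_append_le]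
      rfl
    · exact abs_sub_replicate_append_le n c 0 f

theorem geom_sum_le_pow_div {x : ℝ} (hx : 1 < x) (n : ℕ) :
    ∑ i ∈ Finset.range n, x ^ i ≤ x ^ n / (x - 1) := by
  rw [geom_sum_eq hx.ne']
  have := sub_pos.2 hx
  gcongr
  exact sub_le_self _ zero_le_one

theorem exists_resBound_two :
    ∃ A : ℝ, 0 < A ∧ ∀ n, ResBound q 2 n (A * √(growth q) ^ n) := by
  have hμ : 1 < √(growth q) := one_lt_sqrt_growth
  set μ := √(growth q)
  have hμ' : 0 < μ - 1 := sub_pos.2 hμ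
  have hsum (n : ℕ) : ∑ k ∈ Finset.range n, (2 * ∑ i ∈ Finset.range k, μ ^ i + 1)
      ≤ (2 / (μ - 1) + 1) / (μ - 1) * μ ^ n := calc
    _ ≤ ∑ k ∈ Finset.range n, (2 / (μ - 1) + 1) * μ ^ k := by
      refine Finset.sum_le_sum fun k _ => ?_
      grw [geom_sum_le_pow_div hμ]
      calc 2 * (μ ^ k / (μ - 1)) + 1 ≤ 2 * (μ ^ k / (μ - 1)) + μ ^ k := by
              gcongr
              exact one_le_pow₀ hμ.le
        _ = (2 / (μ - 1) + 1) * μ ^ k := by ring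
    _ ≤ (2 / (μ - 1) + 1) * (μ ^ n / (μ - 1)) := by
      rw [← Finset.mul_sum]
      grw [geom_sum_le_pow_div hμ]
    _ = _ := by ring
  refine ⟨2 * ((2 / (μ - 1) + 1) / (μ - 1)), by positivity, fun n f x y hx hy => ?_⟩
  calc |f x - f y| ≤ |f x - f (List.replicate n 0)| + |f (List.replicate n 0) - f y| :=
        abs_sub_le _ _ _
    _ ≤ (2 / (μ - 1) + 1) / (μ - 1) * μ ^ n * √(energy 2 n f)
        + (2 / (μ - 1) + 1) / (μ - 1) * μ ^ n * √(energy 2 n f) := by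
      rw [abs_sub_comm _ (f y)]
      grw [abs_sub_replicate_le hx, abs_sub_replicate_le hy, hsum]
    _ = _ := by ring

end DegreeZero

/-! ### Degree one -/

section DegreeOne

variable {q : ℕ}

/-- A word of length `k + 1` whose last letter differs from `c`. -/
def tailWord {k : ℕ} (c : Fin (q + 1)) (t : List.Vector (Fin (q + 1)) k × Fin q) : Word q :=
  t.1.1 ++ [c.succAbove t.2]

/-- The average of `f` over the words `0ᴹ a v` with `a ≠ 0` and `v` a word of length `k + 1` whose
last letter differs from `c`. -/
noncomputable def spread (M k : ℕ) (c : Fin (q + 1)) (f : Word q → ℝ) : ℝ :=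
  𝔼 a : Fin q, 𝔼 t : List.Vector (Fin (q + 1)) k × Fin q, f (zerosCons M a (tailWord c t))

theorem length_tailWord {k : ℕ} (c : Fin (q + 1)) (t : List.Vector (Fin (q + 1)) k × Fin q) :
    (tailWord c t).length = k + 1 := by
  rw [tailWord, List.length_append, t.1.2, List.length_singleton]

theorem prefixEnergy_concat_add_le {K M n : ℕ} (hM : M ≤ n) (c : Fin (q + 1)) (f : Word q → ℝ) :
    prefixEnergy K M n (fun u => f (u ++ [c]))
      + ∑ a : Fin q, energy K (n - M) (fun u => f (zerosCons M a u))
      ≤ prefixEnergy K (M + 1) (n + 1) f := by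
  rw [prefixEnergy, prefixEnergy, Finset.sum_range_succ, Nat.add_sub_add_right]
  refine add_le_add_left (Finset.sum_le_sum fun i hi => Finset.sum_le_sum fun a _ => ?_) _
  have hi : n + 1 - (i + 1) = n - (i + 1) + [c].length := by
    have := Finset.mem_range.1 hi
    simp only [List.length_singleton]
    omega
  simp only [zerosCons_append, hi]
  exact energy_append_le K _ [c] fun u => f (zerosCons i a u)

theorem sum_energy_tailWord_le (K n k : ℕ) (c : Fin (q + 1)) (f : Word q → ℝ) :
    ∑ p : Fin q × (List.Vector (Fin (q + 1)) k × Fin q),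
      energy K n (fun u => f (u ++ p.1.succ :: tailWord c p.2))
      ≤ ∑ i : Fin q, energy K (n + (k + 1)) (fun u => f (u ++ [c.succAbove i])) := by
  have hinj : Function.Injective
      fun r : Fin q × List.Vector (Fin (q + 1)) k => (r.1.succ :: r.2.1 : Word q) := by
    rintro ⟨a, v⟩ ⟨b, w⟩ h
    obtain ⟨hab, hvw⟩ := List.cons_eq_cons.1 h
    exact Prod.ext (Fin.succ_injective _ hab) (Subtype.ext hvw)
  calc ∑ p : Fin q × (List.Vector (Fin (q + 1)) k × Fin q),
        energy K n (fun u => f (u ++ p.1.succ :: tailWord c p.2))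
      = ∑ r : (Fin q × List.Vector (Fin (q + 1)) k) × Fin q,
          energy K n (fun u => f (u ++ r.1.1.succ :: tailWord c (r.1.2, r.2))) :=
        ((Equiv.prodAssoc _ _ _).sum_comp _).symm
    _ = ∑ i : Fin q, ∑ r : Fin q × List.Vector (Fin (q + 1)) k,
          energy K n (fun u => f ((u ++ r.1.succ :: r.2.1) ++ [c.succAbove i])) := by
        simp only [Fintype.sum_prod_type_right, tailWord, List.append_assoc, List.cons_append]
    _ ≤ _ := Finset.sum_le_sum fun i _ => sum_energy_append_le K n (k + 1) hinj
        (fun r => by simp) fun u => f (u ++ [c.succAbove i])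

theorem spread_sub_spread_succ (M k : ℕ) (c c' : Fin (q + 1)) (f : Word q → ℝ) :
    spread M k c (fun u => f (u ++ [c'])) - spread (M + 1) k c' f
      = (𝔼 a : Fin q, 𝔼 t : List.Vector (Fin (q + 1)) k × Fin q,
            f (zerosCons M a (tailWord c t ++ [c']))
          - 𝔼 a : Fin q, 𝔼 p : Fin q × (List.Vector (Fin (q + 1)) k × Fin q),
              f (zerosCons M a (p.1.succ :: tailWord c' p.2)))
        - 𝔼 p : Fin q × (List.Vector (Fin (q + 1)) k × Fin q),
            cornerGap M (fun u => f (u ++ p.1.succ :: tailWord c' p.2)) := by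
  have hspread : spread (M + 1) k c' f
      = 𝔼 p : Fin q × (List.Vector (Fin (q + 1)) k × Fin q),
          f (List.replicate (M + 1) 0 ++ p.1.succ :: tailWord c' p.2) :=
    (Finset.expect_product' Finset.univ Finset.univ fun b t =>
      f (zerosCons (M + 1) b (tailWord c' t))).symm
  rw [hspread, Finset.expect_comm (s := Finset.univ (α := Fin q))
    (t := Finset.univ (α := Fin q × (List.Vector (Fin (q + 1)) k × Fin q)))]
  simp only [spread, cornerGap, Finset.expect_sub_distrib, zerosCons_append, List.nil_append]
  ring

variable [NeZero q]

instance (k : ℕ) : Nonempty (List.Vector (Fin (q + 1)) k × Fin q) := ⟨.replicate k 0, 0⟩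

theorem abs_expect_zerosCons_sub_le {ι κ : Type*} [Fintype ι] [Nonempty ι] [Fintype κ] [Nonempty κ]
    {K L : ℕ} {ρ : ℝ} (hρ : 0 ≤ ρ) (hres : ResBound q K L ρ) (M : ℕ) {u : ι → Word q}
    {v : κ → Word q} (hu : ∀ i, (u i).length = L) (hv : ∀ j, (v j).length = L) (f : Word q → ℝ) :
    |𝔼 a, 𝔼 i, f (zerosCons M a (u i)) - 𝔼 a, 𝔼 j, f (zerosCons M a (v j))|
      ≤ ρ * √(∑ a : Fin q, energy K L (fun w => f (zerosCons M a w))) := by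
  rw [← Finset.expect_sub_distrib]
  exact abs_expect_le_mul_sqrt hρ (fun a => energy_nonneg _ _ _) (fun a =>
    abs_expect_sub_expect_le fun i j => hres (fun w => f (zerosCons M a w)) _ _ (hu i) (hv j))
    le_rfl

theorem abs_expect_cornerGap_tailWord_le {M : ℕ} {D : ℝ} (hD : 0 ≤ D)
    (hgap : ∀ f : Word q → ℝ, |cornerGap M f| ≤ D * √(energy 3 (M + 1) f)) (k : ℕ)
    (c : Fin (q + 1)) (f : Word q → ℝ) :
    |𝔼 p : Fin q × (List.Vector (Fin (q + 1)) k × Fin q),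
        cornerGap M (fun u => f (u ++ p.1.succ :: tailWord c p.2))|
      ≤ D / √((q + 1) ^ k) * √(∑ i : Fin q, energy 3 (M + 1 + (k + 1))
          (fun u => f (u ++ [c.succAbove i]))) := by
  have hq : (1 : ℝ) ≤ q := by exact_mod_cast NeZero.one_le
  have hcard : ((q : ℝ) + 1) ^ k
      ≤ Fintype.card (Fin q × (List.Vector (Fin (q + 1)) k × Fin q)) := by
    simp only [Fintype.card_prod, Fintype.card_fin, card_vector]
    push_cast
    calc ((q : ℝ) + 1) ^ k = 1 * ((q + 1) ^ k * 1) := by ring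
      _ ≤ q * ((q + 1) ^ k * q) := by gcongr
  refine (abs_expect_le_div_sqrt_card hD (fun _ => energy_nonneg _ _ _) (fun p => hgap _)
    (sum_energy_tailWord_le 3 (M + 1) k c f)).trans ?_
  gcongr

theorem abs_spread_sub_spread_succ_le {M k : ℕ} {ρ D : ℝ} (hρ : 0 ≤ ρ)
    (hres : ResBound q 2 (k + 2) ρ) (hD : 0 ≤ D)
    (hgap : ∀ f : Word q → ℝ, |cornerGap M f| ≤ D * √(energy 3 (M + 1) f))
    (c c' : Fin (q + 1)) (f : Word q → ℝ) :
    |spread M k c (fun u => f (u ++ [c'])) - spread (M + 1) k c' f|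
      ≤ ρ * √(∑ a : Fin q, energy 2 (k + 2) (fun w => f (zerosCons M a w)))
        + D / √((q + 1) ^ k) * √(∑ i : Fin q, energy 3 (M + 1 + (k + 1))
            (fun u => f (u ++ [c'.succAbove i]))) := by
  rw [spread_sub_spread_succ]
  exact (abs_sub _ _).trans (add_le_add
    (abs_expect_zerosCons_sub_le hρ hres M (fun t => by simp [length_tailWord])
      (fun p => by simp [length_tailWord]) f)
    (abs_expect_cornerGap_tailWord_le hD hgap k c' f))

theorem sqrt_natCast_mul_sqrt_add_sqrt_le (M : ℕ) {x y z : ℝ} (hx : 0 ≤ x) (hy : 0 ≤ y)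
    (hz : x + y ≤ z) : √M * √x + √y ≤ √(M + 1 : ℕ) * √z := by
  grw [← hz]
  simpa using sqrt_mul_add_sqrt_mul_le M.cast_nonneg zero_le_one hx hy

theorem abs_sub_spread_le {k : ℕ} {ρ D : ℝ} (hρ : 0 ≤ ρ) (hres : ResBound q 2 (k + 2) ρ)
    (hD : 0 ≤ D) (M : ℕ)
    (hgap : ∀ j < M, ∀ f : Word q → ℝ, |cornerGap j f| ≤ D * √(energy 3 (j + 1) f))
    (f : Word q → ℝ) {y : Word q} (c : Fin (q + 1)) (hy : y.length = M + 1 + k) :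
    |f (y ++ [c]) - spread M k c f|
      ≤ ρ * √(energy 3 (M + 1 + k + 1) f) + ρ * (√M * √(prefixEnergy 2 M (M + 1 + k + 1) f))
        + D / √((q + 1) ^ k) * (√M * √(energy 3 (M + 1 + k + 1) f)) := by
  induction M generalizing f y c with
  | zero =>
    have hres' : ResBound q 3 (k + 2) ρ := hres.mono (by norm_num) le_rfl hρ
    rw [show 0 + 1 + k + 1 = k + 2 by ring]
    simp only [CharP.cast_eq_zero, Real.sqrt_zero, zero_mul, mul_zero, add_zero]
    exact abs_sub_expect_le fun a => abs_sub_expect_le fun t => hres' f _ _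
      (by simp; omega) (by simp [length_zerosCons, length_tailWord]; omega)
  | succ M ih =>
    obtain ⟨y, c', rfl⟩ :=
      (List.eq_nil_or_concat' y).resolve_left (by rintro rfl; simp at hy; omega)
    have hy' : y.length = M + 1 + k := by
      rw [List.length_append, List.length_singleton] at hy
      omega
    set n := M + 1 + k + 1
    rw [show M + 1 + 1 + k + 1 = n + 1 by omega]
    have hM : n - M = k + 2 := by omega
    set S := ∑ a : Fin q, energy 2 (k + 2) fun w => f (zerosCons M a w)
    set R := ∑ i : Fin q, energy 3 n fun u => f (u ++ [c.succAbove i])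
    have hprefix := sqrt_natCast_mul_sqrt_add_sqrt_le M (y := S)
      (prefixEnergy_nonneg 2 M n fun u => f (u ++ [c]))
      (Finset.sum_nonneg fun _ _ => energy_nonneg _ _ _)
      (by simpa only [hM] using prefixEnergy_concat_add_le (K := 2) (by omega : M ≤ n) c f)
    have hsuffix := sqrt_natCast_mul_sqrt_add_sqrt_le M (y := R)
      (energy_nonneg 3 n fun u => f (u ++ [c]))
      (Finset.sum_nonneg fun _ _ => energy_nonneg _ _ _) (energy_concat_add_le 3 n c f)
    calc |f (y ++ [c'] ++ [c]) - spread (M + 1) k c f|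
        ≤ |f (y ++ [c'] ++ [c]) - spread M k c' (fun u => f (u ++ [c]))|
          + |spread M k c' (fun u => f (u ++ [c])) - spread (M + 1) k c f| := abs_sub_le _ _ _
      _ ≤ (ρ * √(energy 3 n fun u => f (u ++ [c]))
            + ρ * (√M * √(prefixEnergy 2 M n fun u => f (u ++ [c])))
            + D / √((q + 1) ^ k) * (√M * √(energy 3 n fun u => f (u ++ [c]))))
          + (ρ * √S + D / √((q + 1) ^ k) * √R) :=
        add_le_add (ih (fun j hj => hgap j (hj.trans M.lt_succ_self))
            (fun u => f (u ++ [c])) c' hy')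
          (abs_spread_sub_spread_succ_le hρ hres hD (hgap M M.lt_succ_self) c' c f)
      _ = ρ * √(energy 3 n fun u => f (u ++ [c]))
          + ρ * (√M * √(prefixEnergy 2 M n fun u => f (u ++ [c])) + √S)
          + D / √((q + 1) ^ k) * (√M * √(energy 3 n fun u => f (u ++ [c])) + √R) := by ring
      _ ≤ _ := by
        grw [hprefix, hsuffix, energy_append_le]
        rfl

theorem abs_spread_sub_spread_le {k : ℕ} {ρ : ℝ} (hρ : 0 ≤ ρ) (hres : ResBound q 2 (k + 1) ρ)
    (M : ℕ) (c c' : Fin (q + 1)) (f : Word q → ℝ) :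
    |spread M k c f - spread M k c' f| ≤ ρ * √(energy 3 (M + 1 + k + 1) f) := by
  have h :=
    abs_expect_zerosCons_sub_le hρ hres M (length_tailWord (k := k) c) (length_tailWord c') f
  grw [sum_energy_zerosCons_le] at h
  exact h

theorem resBound_of_abs_sub_spread_le {M k : ℕ} {ρ B : ℝ} (hρ : 0 ≤ ρ)
    (hres : ResBound q 2 (k + 1) ρ)
    (hB : ∀ (f : Word q → ℝ) (y : Word q) (c : Fin (q + 1)), y.length = M + 1 + k →
      |f (y ++ [c]) - spread M k c f| ≤ B * √(energy 3 (M + 1 + k + 1) f)) :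
    ResBound q 3 (M + 1 + k + 1) (2 * B + ρ) := fun f x y hx hy => by
  obtain ⟨x, c, rfl⟩ := (List.eq_nil_or_concat' x).resolve_left (by rintro rfl; simp at hx)
  obtain ⟨y, c', rfl⟩ := (List.eq_nil_or_concat' y).resolve_left (by rintro rfl; simp at hy)
  calc |f (x ++ [c]) - f (y ++ [c'])|
      ≤ |f (x ++ [c]) - spread M k c f| + |spread M k c f - f (y ++ [c'])| := abs_sub_le _ _ _
    _ ≤ |f (x ++ [c]) - spread M k c f|
        + (|spread M k c f - spread M k c' f| + |spread M k c' f - f (y ++ [c'])|) := by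
      grw [abs_sub_le (spread M k c f) (spread M k c' f)]
    _ ≤ B * √(energy 3 (M + 1 + k + 1) f) + (ρ * √(energy 3 (M + 1 + k + 1) f)
        + B * √(energy 3 (M + 1 + k + 1) f)) := by
      rw [abs_sub_comm _ (f _)]
      grw [hB f x c (by simpa using hx), hB f y c' (by simpa using hy),
        abs_spread_sub_spread_le hρ hres]
    _ = _ := by ring

theorem ResBound.abs_cornerGap_le {K n : ℕ} {D : ℝ} (h : ResBound q K (n + 1) D) (f : Word q → ℝ) :
    |cornerGap n f| ≤ D * √(energy K (n + 1) f) :=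
  abs_sub_expect_le fun a => h f _ _ (by simp) (by simp [length_zerosCons])

theorem resBound_three_of_mul_le_pow {N k : ℕ} {ρ : ℝ} (hρ : 0 ≤ ρ)
    (hres : ∀ j ≤ k + 2, ResBound q 2 j ρ) (hk : 16 * N ≤ (q + 1) ^ k) {n : ℕ} (hn : n ≤ N) :
    ResBound q 3 n (10 * ρ * √N) := by
  induction n using Nat.strong_induction_on with
  | _ n ih =>
  obtain rfl | hn0 := n.eq_zero_or_pos
  · exact resBound_length_zero 3 (by positivity)
  have hN : 1 ≤ √(N : ℝ) := Real.one_le_sqrt.2 (by exact_mod_cast hn0.trans_le hn)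
  have hρN : ρ ≤ ρ * √N := le_mul_of_one_le_right hρ hN
  obtain hnk | hnk := le_or_gt n (k + 2)
  · exact (hres n hnk).mono (by norm_num) (by linarith) (by positivity)
  obtain ⟨M, rfl⟩ : ∃ M, n = M + 1 + k + 1 := ⟨n - k - 2, by omega⟩
  have hM : √(M : ℝ) ≤ √N := Real.sqrt_le_sqrt (by exact_mod_cast (by omega : M ≤ N))
  have hpow : 4 * √(N : ℝ) ≤ √((q + 1) ^ k) := by
    rw [show (4 : ℝ) = √16 by norm_num, ← Real.sqrt_mul (by norm_num)]
    exact Real.sqrt_le_sqrt (by exact_mod_cast hk)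
  have hgap : ∀ j < M, ∀ f : Word q → ℝ, |cornerGap j f| ≤ 10 * ρ * √N * √(energy 3 (j + 1) f) :=
    fun j hj f => (ih (j + 1) (by omega) (by omega)).abs_cornerGap_le f
  have hscale : 10 * ρ * √N / √((q + 1) ^ k) * √M ≤ 5 / 2 * (ρ * √N) := calc
    _ ≤ 10 * ρ * √N / (4 * √N) * √N := by gcongr
    _ = _ := by field_simp; ring
  -- The constant `10` reproduces itself: `2 * (1 + 1 + 5 / 2) + 1 = 10`.
  refine (resBound_of_abs_sub_spread_le (B := ρ + ρ * √N + 5 / 2 * (ρ * √N)) hρ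
    (hres _ (by omega)) fun f y c hy => ?_).mono le_rfl (by linarith) (by positivity)
  refine (abs_sub_spread_le hρ (hres _ le_rfl) (by positivity) M hgap f c hy).trans ?_
  grw [prefixEnergy_le 2 (by omega) f, ← mul_assoc, ← mul_assoc, hscale, hM]
  exact (by ring : _ = _).le

theorem growth_eq_rpow : growth q = (q + 1 : ℝ) ^ (1 - Real.logb (q + 1) q) := by
  have hq : (0 : ℝ) < q := Nat.cast_pos.2 (NeZero.pos q)
  rw [Real.rpow_sub (by positivity), Real.rpow_one,
    Real.rpow_logb (by positivity) (by linarith) hq, growth]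

theorem sqrt_growth_pow (k : ℕ) :
    √(growth q) ^ k = ((q + 1 : ℝ) ^ k) ^ ((1 - Real.logb (q + 1) q) / 2) := by
  have hq : (0 : ℝ) ≤ q + 1 := by positivity
  rw [growth_eq_rpow, Real.sqrt_eq_rpow, ← Real.rpow_mul hq, ← Real.rpow_mul_natCast hq,
    ← Real.rpow_natCast_mul hq]
  congr 1
  ring

theorem logb_lt_one : Real.logb (q + 1 : ℝ) q < 1 := by
  have hq : (0 : ℝ) < q := Nat.cast_pos.2 (NeZero.pos q)
  rw [Real.logb_lt_iff_lt_rpow (by linarith) hq, Real.rpow_one]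
  linarith

theorem exists_le_pow_and_pow_add_two_le {n : ℕ} (hn : 1 ≤ n) :
    ∃ k, 16 * n ≤ (q + 1) ^ k ∧ (q + 1) ^ (k + 2) ≤ 16 * (q + 1) ^ 3 * n := by
  have hq : 1 < q + 1 := Nat.lt_add_of_pos_left (NeZero.pos q)
  obtain ⟨k, hk, hk'⟩ := exists_nat_pow_near (by omega : 1 ≤ 16 * n) hq
  refine ⟨k + 1, hk'.le, ?_⟩
  calc (q + 1) ^ (k + 1 + 2) = (q + 1) ^ k * (q + 1) ^ 3 := by ring
    _ ≤ 16 * n * (q + 1) ^ 3 := by gcongr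
    _ = 16 * (q + 1) ^ 3 * n := by ring

theorem exists_resBound_three :
    ∃ A : ℝ, 0 < A ∧ ∀ n : ℕ, 1 ≤ n →
      ResBound q 3 n (A * (n : ℝ) ^ ((2 - Real.logb (q + 1) q) / 2)) := by
  obtain ⟨A, hA, h⟩ := exists_resBound_two (q := q)
  set L := Real.logb (q + 1 : ℝ) q
  have hL : 0 ≤ (1 - L) / 2 := by linarith [logb_lt_one (q := q)]
  set B : ℝ := (16 * (q + 1) ^ 3) ^ ((1 - L) / 2)
  refine ⟨10 * (A * B), by positivity, fun n hn => ?_⟩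
  obtain ⟨k, hk, hk'⟩ := exists_le_pow_and_pow_add_two_le (q := q) hn
  have hpow : √(growth q) ^ (k + 2) ≤ B * (n : ℝ) ^ ((1 - L) / 2) := by
    rw [sqrt_growth_pow, ← Real.mul_rpow (by positivity) (by positivity)]
    gcongr
    exact_mod_cast hk'
  have hres (j : ℕ) (hj : j ≤ k + 2) : ResBound q 2 j (A * √(growth q) ^ (k + 2)) :=
    (h j).mono le_rfl (by gcongr; exact one_lt_sqrt_growth.le) (by positivity)
  refine (resBound_three_of_mul_le_pow (by positivity) hres hk le_rfl).mono le_rfl ?_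
    (by positivity)
  calc 10 * (A * √(growth q) ^ (k + 2)) * √n
      ≤ 10 * (A * (B * (n : ℝ) ^ ((1 - L) / 2))) * √n := by gcongr
    _ = 10 * (A * B) * ((n : ℝ) ^ ((1 - L) / 2) * (n : ℝ) ^ (1 / 2 : ℝ)) := by
      rw [Real.sqrt_eq_rpow]
      ring
    _ = _ := by
      rw [← Real.rpow_add (Nat.cast_pos.2 hn)]
      congr 2
      ring

end DegreeOne

/-! ### Raising the degree -/

section Layers

variable {q : ℕ}

/-- The word `0ˢ a 0ᵗ` of length `h = s + 1 + t`, for the pair `p = (s, a)`. -/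
def singleLetter {h : ℕ} (p : Fin h × Fin q) : Word q :=
  zerosCons p.1 p.2 (List.replicate p.1.rev 0)

/-- The average of `f` over the words `0ˡ 0ˢ a 0ᵗ` of length `l + h` with `a ≠ 0`. -/
noncomputable def layer (l h : ℕ) (f : Word q → ℝ) : ℝ :=
  𝔼 p : Fin h × Fin q, f (List.replicate l 0 ++ singleLetter p)

theorem length_singleLetter {h : ℕ} (p : Fin h × Fin q) : (singleLetter p).length = h := by
  have := p.1.2
  rw [singleLetter, length_zerosCons, List.length_replicate, Fin.val_rev]
  omega

theorem zerosCons_inj {i j : ℕ} {a b : Fin q} {u v : Word q}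
    (h : zerosCons i a u = zerosCons j b v) : i = j ∧ a = b := by
  induction i generalizing j with
  | zero => cases j <;> simp_all [zerosCons, List.replicate_succ]
  | succ i ih =>
    cases j with
    | zero => simp [zerosCons, List.replicate_succ, (Fin.succ_ne_zero _).symm] at h
    | succ j => simpa using ih (List.cons_injective h)

theorem singleLetter_injective (h : ℕ) :
    Function.Injective (singleLetter : Fin h × Fin q → Word q) := fun _ _ hp =>
  have hinj := zerosCons_inj hp
  Prod.ext (Fin.ext hinj.1) hinj.2

theorem replicate_append_singleLetter {h : ℕ} (l : ℕ) (p : Fin h × Fin q) :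
    List.replicate l 0 ++ singleLetter p
      = zerosCons (l + p.1) p.2 (List.replicate p.1.rev 0) := by
  rw [singleLetter, zerosCons, zerosCons, ← List.append_assoc, List.replicate_append_replicate]

theorem sum_energy_layer_le (K l h L : ℕ) (f : Word q → ℝ) :
    ∑ p : Fin h × Fin q,
        energy K (l + h + L - (l + p.1 + 1)) (fun w => f (zerosCons (l + p.1) p.2 w))
      ≤ energy (K + 1) (l + h + L) f := by
  refine le_trans ?_ (prefixEnergy_le K (Nat.le_add_right (l + h) L) f)
  rw [prefixEnergy, Finset.sum_range_add, Fintype.sum_prod_type, Fin.sum_univ_eq_sum_range fun s =>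
    ∑ a : Fin q, energy K (l + h + L - (l + s + 1)) (fun w => f (zerosCons (l + s) a w))]
  exact le_add_of_nonneg_left (prefixEnergy_nonneg K l _ f)

theorem exists_append_of_length_eq_add {k l : ℕ} {x : Word q} (hx : x.length = k + l) :
    ∃ u w, x = u ++ w ∧ u.length = k ∧ w.length = l :=
  ⟨x.take k, x.drop k, (List.take_append_drop k x).symm, by simp [hx], by simp [hx]⟩

variable [NeZero q]

theorem div_sqrt_card_le {h : ℕ} [NeZero h] {ρ : ℝ} (hρ : 0 ≤ ρ) :
    ρ / √(Fintype.card (Fin h × Fin q)) ≤ ρ / √h := by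
  have hh : (0 : ℝ) < h := Nat.cast_pos.2 (NeZero.pos h)
  gcongr
  simpa using Nat.le_mul_of_pos_right h (NeZero.pos q)

theorem abs_expect_layer_sub_le {ι κ : Type*} [Fintype ι] [Nonempty ι] [Fintype κ] [Nonempty κ]
    {K L h : ℕ} [NeZero h] {ρ : ℝ} (hρ : 0 ≤ ρ) (hres : ∀ n ≤ h + L, ResBound q K n ρ) (l : ℕ)
    {u : ι → Word q} {v : κ → Word q} (hu : ∀ i, (u i).length = L) (hv : ∀ j, (v j).length = L)
    (f : Word q → ℝ) :
    |𝔼 i, layer l h (fun w => f (w ++ u i)) - 𝔼 j, layer l h (fun w => f (w ++ v j))|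
      ≤ ρ / √h * √(energy (K + 1) (l + h + L) f) := by
  have hlength {s : ℕ} (hs : s < h) (i : ℕ) (hi : i = L) :
      h - (s + 1) + i = l + h + L - (l + s + 1) := by omega
  simp only [layer, replicate_append_singleLetter, zerosCons_append]
  rw [Finset.expect_comm, Finset.expect_comm (s := Finset.univ (α := κ)),
    ← Finset.expect_sub_distrib]
  refine (abs_expect_le_div_sqrt_card hρ (fun _ => energy_nonneg _ _ _) (fun p =>
    abs_expect_sub_expect_le fun i j => ?_) (sum_energy_layer_le K l h L f)).trans ?_
  · exact hres _ (by omega) (fun w => f (zerosCons (l + p.1) p.2 w)) _ _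
      (by simpa using hlength p.1.2 _ (hu i)) (by simpa using hlength p.1.2 _ (hv j))
  · grw [div_sqrt_card_le hρ]

theorem abs_sub_layer_add_le {K l h h' : ℕ} [NeZero h] [NeZero h'] {ρ e : ℝ} (hρ : 0 ≤ ρ)
    (hres : ∀ n ≤ h + h', ResBound q K n ρ) (he : 0 ≤ e)
    (hlayer : ∀ (f : Word q → ℝ) (x : Word q), x.length = l + h →
      |f x - layer l h f| ≤ e * √(energy (K + 1) (l + h) f))
    (f : Word q → ℝ) {x : Word q} (hx : x.length = l + h + h') :
    |f x - layer (l + h) h' f|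
      ≤ ((1 + 1 / √h') * e + ρ / √h) * √(energy (K + 1) (l + h + h') f) := by
  obtain ⟨x, w, rfl, hx, hw⟩ := exists_append_of_length_eq_add hx
  have hstart : |f (x ++ w) - layer l h (fun u => f (u ++ w))|
      ≤ e * √(energy (K + 1) (l + h + h') f) := by
    grw [hlayer (fun u => f (u ++ w)) x hx, energy_append_le, hw]
  have hchange : |layer l h (fun u => f (u ++ w))
      - 𝔼 p : Fin h' × Fin q, layer l h (fun u => f (u ++ singleLetter p))|
      ≤ ρ / √h * √(energy (K + 1) (l + h + h') f) := by
    simpa using abs_expect_layer_sub_le (ι := Unit) hρ hres l (fun _ => hw) length_singleLetter f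
  have hend : |𝔼 p : Fin h' × Fin q, (f (List.replicate (l + h) 0 ++ singleLetter p)
      - layer l h (fun u => f (u ++ singleLetter p)))|
      ≤ e / √h' * √(energy (K + 1) (l + h + h') f) := by
    refine (abs_expect_le_div_sqrt_card he (fun _ => energy_nonneg _ _ _) (fun p =>
      hlayer (fun u => f (u ++ singleLetter p)) _ (by simp))
      (sum_energy_append_le (K + 1) (l + h) h'
        (singleLetter_injective h') length_singleLetter f)).trans ?_
    grw [div_sqrt_card_le he]
  rw [Finset.expect_sub_distrib, abs_sub_comm] at hend
  grw [abs_sub_le _ (layer l h fun u => f (u ++ w)), abs_sub_le (layer l h fun u => f (u ++ w))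
    (𝔼 p : Fin h' × Fin q, layer l h fun u => f (u ++ singleLetter p)), hstart, hchange]
  unfold layer at hend ⊢
  grw [hend]
  exact (by ring : _ = _).le

/-- The constant that comes from comparing `f` with its average over the first `j` layers in turn,
when passing to the next layer costs `σ i`. -/
noncomputable def layerBound (σ : ℕ → ℝ) : ℕ → ℝ
  | 0 => 1
  | j + 1 => (1 + 1 / √((2 : ℝ) ^ (j + 1))) * layerBound σ j + σ j

theorem layerBound_nonneg {σ : ℕ → ℝ} (hσ : ∀ i, 0 ≤ σ i) (j : ℕ) : 0 ≤ layerBound σ j := by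
  induction j with
  | zero => exact zero_le_one
  | succ j ih => exact add_nonneg (by positivity) (hσ j)

theorem geom_sum_le_inv_one_sub {x : ℝ} (hx : 0 ≤ x) (hx1 : x < 1) (n : ℕ) :
    ∑ i ∈ Finset.range n, x ^ i ≤ (1 - x)⁻¹ := by
  rw [← tsum_geometric_of_lt_one hx hx1]
  exact (summable_geometric_of_lt_one hx hx1).sum_le_tsum _ fun i _ => by positivity

theorem sum_one_div_sqrt_two_pow_le (j : ℕ) :
    ∑ i ∈ Finset.range j, 1 / √((2 : ℝ) ^ (i + 1)) ≤ 4 := by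
  have hsqrt (i : ℕ) : 1 / √((2 : ℝ) ^ (i + 1)) = 1 / √2 * (1 / √2) ^ i := by
    rw [Real.sqrt_eq_rpow, Real.sqrt_eq_rpow, ← Real.rpow_pow_comm zero_le_two]
    ring
  have hratio : 1 / √(2 : ℝ) ≤ 3 / 4 := by
    rw [div_le_iff₀ (by positivity), ← div_le_iff₀' (by norm_num)]
    exact Real.le_sqrt_of_sq_le (by norm_num)
  have hinv : 0 ≤ (1 - 1 / √(2 : ℝ))⁻¹ := inv_nonneg.2 (by linarith)
  simp only [hsqrt, ← Finset.mul_sum]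
  calc 1 / √2 * ∑ i ∈ Finset.range j, (1 / √(2 : ℝ)) ^ i
      ≤ 1 / √2 * (1 - 1 / √2)⁻¹ := by
        grw [geom_sum_le_inv_one_sub (by positivity) (by linarith)]
    _ ≤ 3 / 4 * (1 - 3 / 4)⁻¹ := by gcongr
    _ ≤ 4 := by norm_num

theorem layerBound_le {σ : ℕ → ℝ} (hσ : ∀ i, 0 ≤ σ i) (j : ℕ) :
    layerBound σ j ≤ Real.exp 4 * (1 + ∑ i ∈ Finset.range j, σ i) := by
  have h := discrete_gronwall (u := layerBound σ) (c := fun i => 1 / √((2 : ℝ) ^ (i + 1)))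
    zero_le_one (fun _ _ => le_rfl) (fun _ _ => by positivity) (fun i _ => hσ i) j.zero_le
  rw [← Finset.range_eq_Ico, layerBound] at h
  have : 0 ≤ ∑ i ∈ Finset.range j, σ i := Finset.sum_nonneg fun i _ => hσ i
  grw [h, sum_one_div_sqrt_two_pow_le]
  exact (mul_comm _ _).le

theorem mul_sqrt_two_pow_div_sqrt_cast (x : ℝ) (j : ℕ) :
    x * √(2 ^ j) / √((2 ^ j : ℕ) : ℝ) = x := by
  rw [Nat.cast_pow, Nat.cast_ofNat]
  exact mul_div_cancel_right₀ x (by positivity)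

theorem abs_sub_layer_le {K : ℕ} {σ : ℕ → ℝ} (hσ : ∀ i, 0 ≤ σ i)
    (hres : ∀ i, ∀ n ≤ 4 * 2 ^ i, ResBound q K n (σ i * √(2 ^ i))) (j : ℕ) (f : Word q → ℝ)
    (x : Word q) (hx : x.length = 2 ^ j - 1 + 2 ^ j) :
    |f x - layer (2 ^ j - 1) (2 ^ j) f|
      ≤ layerBound σ j * √(energy (K + 1) (2 ^ j - 1 + 2 ^ j) f) := by
  induction j generalizing f x with
  | zero =>
    obtain ⟨c, rfl⟩ := List.length_eq_one_iff.1 (show x.length = 1 by simpa using hx)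
    have h : |f [c] - 𝔼 p : Fin 1 × Fin q, f [p.2.succ]| ≤ √(energy (K + 1) 1 f) :=
      abs_sub_expect_le fun p => abs_sub_cons_le (n := 0) (by omega) rfl c p.2.succ f
    simpa [layer, singleLetter, zerosCons, layerBound] using h
  | succ j ih =>
    have hstep := abs_sub_layer_add_le (h' := 2 ^ (j + 1)) (mul_nonneg (hσ j) (Real.sqrt_nonneg _))
      (fun n hn => hres j n (by rw [pow_succ] at hn; omega)) (layerBound_nonneg hσ j) ih f (x := x)
    have hj : 1 ≤ 2 ^ j := Nat.one_le_two_pow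
    rw [mul_sqrt_two_pow_div_sqrt_cast, show 2 ^ j - 1 + 2 ^ j = 2 ^ (j + 1) - 1 by omega,
      Nat.cast_pow, Nat.cast_ofNat] at hstep
    exact hstep hx

theorem resBound_succ {K : ℕ} {σ : ℕ → ℝ} (hσ : ∀ i, 0 ≤ σ i)
    (hres : ∀ i, ∀ n ≤ 4 * 2 ^ i, ResBound q K n (σ i * √(2 ^ i))) {j n : ℕ}
    (hn : 2 ^ (j + 1) ≤ n + 1) (hn' : n ≤ 4 * 2 ^ j) :
    ResBound q (K + 1) n (2 * Real.exp 4 * (1 + ∑ i ∈ Finset.range (j + 1), σ i)) := by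
  have hj : 1 ≤ 2 ^ j := Nat.one_le_two_pow
  obtain ⟨L, rfl⟩ : ∃ L, n = 2 ^ j - 1 + 2 ^ j + L := Nat.exists_eq_add_of_le (by omega)
  have hbound : 2 * layerBound σ j + σ j
      ≤ 2 * Real.exp 4 * (1 + ∑ i ∈ Finset.range (j + 1), σ i) := by
    have := hσ j
    have hexp : 1 ≤ Real.exp 4 := Real.one_le_exp (by norm_num)
    rw [Finset.sum_range_succ]
    grw [layerBound_le hσ j]
    nlinarith
  suffices ResBound q (K + 1) (2 ^ j - 1 + 2 ^ j + L) (2 * layerBound σ j + σ j) from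
    this.mono le_rfl hbound ((add_nonneg (by have := layerBound_nonneg hσ j; positivity)
      (hσ j)).trans hbound)
  intro f x y hx hy
  obtain ⟨u, w, rfl, hu, hw⟩ := exists_append_of_length_eq_add hx
  obtain ⟨u', w', rfl, hu', hw'⟩ := exists_append_of_length_eq_add hy
  have hlayer {u w : Word q} (hu : u.length = 2 ^ j - 1 + 2 ^ j) (hw : w.length = L) :
      |f (u ++ w) - layer (2 ^ j - 1) (2 ^ j) (fun u => f (u ++ w))|
        ≤ layerBound σ j * √(energy (K + 1) (2 ^ j - 1 + 2 ^ j + L) f) := by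
    have := layerBound_nonneg hσ j
    grw [abs_sub_layer_le hσ hres j (fun u => f (u ++ w)) u hu, energy_append_le, hw]
  have hchange := abs_expect_layer_sub_le (ι := Unit) (κ := Unit) (h := 2 ^ j)
    (mul_nonneg (hσ j) (Real.sqrt_nonneg _)) (fun n hn => hres j n (by omega)) (2 ^ j - 1)
    (fun _ => hw) (fun _ => hw') f
  rw [Fintype.expect_const, Fintype.expect_const, mul_sqrt_two_pow_div_sqrt_cast] at hchange
  have hlast := hlayer hu' hw'
  rw [abs_sub_comm] at hlast
  grw [abs_sub_le _ (layer (2 ^ j - 1) (2 ^ j) fun u => f (u ++ w)),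
    abs_sub_le (layer (2 ^ j - 1) (2 ^ j) fun u => f (u ++ w))
      (layer (2 ^ j - 1) (2 ^ j) fun u => f (u ++ w')), hlayer hu hw, hchange, hlast]
  exact (by ring : _ = _).le

theorem exists_two_pow_le {n : ℕ} (hn : 1 ≤ n) : ∃ j, 2 ^ (j + 1) ≤ n + 1 ∧ n ≤ 4 * 2 ^ j := by
  obtain ⟨j, hj, hj'⟩ := exists_nat_pow_near (by omega : 1 ≤ (n + 1) / 2) one_lt_two
  exact ⟨j, by rw [pow_succ]; omega, by rw [pow_succ] at hj'; omega⟩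

theorem exists_resBound_succ_of_rpow {K : ℕ} {α C : ℝ} (hα : 0 ≤ α) (hC : 0 ≤ C)
    (h : ∀ n : ℕ, 1 ≤ n → ResBound q K n (C * (n : ℝ) ^ α)) :
    ∃ D : ℝ, 0 ≤ D ∧ ∀ n : ℕ, 1 ≤ n → ∃ j : ℕ, 2 ^ (j + 1) ≤ n + 1 ∧
      ResBound q (K + 1) n
        (2 * Real.exp 4 * (1 + D * ∑ i ∈ Finset.range (j + 1), ((2 : ℝ) ^ (α - 1 / 2)) ^ i)) := by
  have hscale (i : ℕ) : ((2 : ℝ) ^ (α - 1 / 2)) ^ i * √(2 ^ i) = (2 ^ i) ^ α := by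
    rw [Real.rpow_pow_comm zero_le_two, Real.sqrt_eq_rpow, ← Real.rpow_add (by positivity),
      sub_add_cancel]
  have hres (i n : ℕ) (hn : n ≤ 4 * 2 ^ i) :
      ResBound q K n (C * 4 ^ α * ((2 : ℝ) ^ (α - 1 / 2)) ^ i * √(2 ^ i)) := by
    rw [mul_assoc, hscale, mul_assoc, ← Real.mul_rpow (by norm_num) (by positivity)]
    obtain rfl | hn0 := n.eq_zero_or_pos
    · exact resBound_length_zero K (by positivity)
    · refine (h n hn0).mono le_rfl ?_ (by positivity)
      gcongr
      exact_mod_cast hn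
  refine ⟨C * 4 ^ α, by positivity, fun n hn => ?_⟩
  obtain ⟨j, hj, hj'⟩ := exists_two_pow_le hn
  refine ⟨j, hj, ?_⟩
  rw [Finset.mul_sum]
  exact resBound_succ (fun i => by positivity) hres hj hj'

theorem exists_resBound_succ_of_half_lt {K : ℕ} {α C : ℝ} (hα : 1 / 2 < α) (hC : 0 ≤ C)
    (h : ∀ n : ℕ, 1 ≤ n → ResBound q K n (C * (n : ℝ) ^ α)) :
    ∃ D : ℝ, 0 < D ∧ ∀ n : ℕ, 1 ≤ n → ResBound q (K + 1) n (D * (n : ℝ) ^ (α - 1 / 2)) := by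
  obtain ⟨D, hD, H⟩ := exists_resBound_succ_of_rpow (by linarith) hC h
  set β := α - 1 / 2
  have hβ : 0 < β := sub_pos.2 hα
  have hratio : 1 < (2 : ℝ) ^ β := Real.one_lt_rpow one_lt_two hβ
  have : 0 < (2 : ℝ) ^ β - 1 := sub_pos.2 hratio
  refine ⟨2 * Real.exp 4 * (1 + D * (2 ^ β / (2 ^ β - 1))), by positivity, fun n hn => ?_⟩
  obtain ⟨j, hj, hres⟩ := H n hn
  refine hres.mono le_rfl ?_ (by positivity)
  have hone : 1 ≤ (n : ℝ) ^ β := Real.one_le_rpow (by exact_mod_cast hn) hβ.le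
  have hsum : ∑ i ∈ Finset.range (j + 1), ((2 : ℝ) ^ β) ^ i
      ≤ 2 ^ β / (2 ^ β - 1) * (n : ℝ) ^ β := by
    grw [geom_sum_le_pow_div hratio, div_mul_eq_mul_div,
      ← Real.mul_rpow zero_le_two n.cast_nonneg, Real.rpow_pow_comm zero_le_two]
    gcongr
    exact_mod_cast (by omega : 2 ^ (j + 1) ≤ 2 * n)
  calc _ ≤ 2 * Real.exp 4 * ((n : ℝ) ^ β + D * (2 ^ β / (2 ^ β - 1) * (n : ℝ) ^ β)) := by
        grw [hone, hsum]
    _ = _ := by ring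

theorem exists_resBound_succ_of_lt_half {K : ℕ} {α C : ℝ} (hα0 : 0 ≤ α) (hα : α < 1 / 2)
    (hC : 0 ≤ C) (h : ∀ n : ℕ, 1 ≤ n → ResBound q K n (C * (n : ℝ) ^ α)) :
    ∃ D : ℝ, 0 < D ∧ ∀ n : ℕ, 1 ≤ n → ResBound q (K + 1) n D := by
  obtain ⟨D, hD, H⟩ := exists_resBound_succ_of_rpow hα0 hC h
  have hratio : (2 : ℝ) ^ (α - 1 / 2) < 1 :=
    Real.rpow_lt_one_of_one_lt_of_neg one_lt_two (sub_neg.2 hα)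
  have : 0 < (1 - (2 : ℝ) ^ (α - 1 / 2))⁻¹ := inv_pos.2 (sub_pos.2 hratio)
  refine ⟨2 * Real.exp 4 * (1 + D * (1 - 2 ^ (α - 1 / 2))⁻¹), by positivity, fun n hn => ?_⟩
  obtain ⟨j, -, hres⟩ := H n hn
  refine hres.mono le_rfl ?_ (by positivity)
  grw [geom_sum_le_inv_one_sub (by positivity) hratio]

theorem exists_resBound_succ_of_eq_half {K : ℕ} {C : ℝ} (hC : 0 ≤ C)
    (h : ∀ n : ℕ, 1 ≤ n → ResBound q K n (C * (n : ℝ) ^ (1 / 2 : ℝ))) :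
    ∃ D : ℝ, 0 < D ∧ ∀ n : ℕ, 2 ≤ n → ResBound q (K + 1) n (D * Real.log n) := by
  obtain ⟨D, hD, H⟩ := exists_resBound_succ_of_rpow (by norm_num) hC h
  have hlog2 : 0 < Real.log 2 := Real.log_pos one_lt_two
  refine ⟨2 * Real.exp 4 * (1 / Real.log 2 + D * (2 / Real.log 2)), by positivity, fun n hn => ?_⟩
  obtain ⟨j, hj, hres⟩ := H n (one_le_two.trans hn)
  have hlogn : Real.log 2 ≤ Real.log n := Real.log_le_log two_pos (by exact_mod_cast hn)
  refine hres.mono le_rfl ?_ (mul_nonneg (by positivity) (hlog2.le.trans hlogn))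
  have hj' : ((j + 1 : ℕ) : ℝ) * Real.log 2 ≤ 2 * Real.log n := by
    rw [← Nat.cast_two, ← Real.log_pow, ← Real.log_pow]
    refine Real.log_le_log (by positivity) ?_
    exact_mod_cast (by nlinarith : 2 ^ (j + 1) ≤ n ^ 2)
  simp only [sub_self, Real.rpow_zero, one_pow, Finset.sum_const, Finset.card_range, nsmul_one]
  calc 2 * Real.exp 4 * (1 + D * ((j + 1 : ℕ) : ℝ))
      ≤ 2 * Real.exp 4 * (Real.log n / Real.log 2 + D * (2 * Real.log n / Real.log 2)) := by
        grw [← (one_le_div hlog2).2 hlogn, ← (le_div_iff₀ hlog2).2 hj']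
    _ = _ := by ring

end Layers

/-! ### Effective resistance -/

section Network

variable {V : Type*} [Fintype V]

/-- The Laplacian of the network on the multigraph `G`, which sends a potential to the net currents
out of the vertices. -/
def laplacian (G : V → V → ℕ) : (V → ℝ) →ₗ[ℝ] V → ℝ where
  toFun v x := ∑ y, (G x y : ℝ) * (v x - v y)
  map_add' u v := by
    ext x
    simp only [Pi.add_apply, ← Finset.sum_add_distrib]
    exact Finset.sum_congr rfl fun y _ => by ring
  map_smul' c v := by
    ext x
    simp only [Pi.smul_apply, smul_eq_mul, RingHom.id_apply, Finset.mul_sum]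
    exact Finset.sum_congr rfl fun y _ => by ring

/-- The Dirichlet form of the multigraph `G`, normalized such that an edge between two different
vertices is counted twice. -/
def dirichletForm (G : V → V → ℕ) (f g : V → ℝ) : ℝ :=
  ∑ x, ∑ y, (G x y : ℝ) * ((f x - f y) * (g x - g y))

variable {G : V → V → ℕ}

theorem dirichletForm_self_nonneg (f : V → ℝ) : 0 ≤ dirichletForm G f f :=
  Finset.sum_nonneg fun _ _ => Finset.sum_nonneg fun _ _ =>
    mul_nonneg (Nat.cast_nonneg _) (mul_self_nonneg _)

theorem dirichletForm_sq_le (f g : V → ℝ) :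
    dirichletForm G f g ^ 2 ≤ dirichletForm G f f * dirichletForm G g g := by
  simp only [dirichletForm, ← Fintype.sum_prod_type']
  exact Finset.sum_sq_le_sum_mul_sum_of_sq_le_mul _
    (fun _ _ => mul_nonneg (Nat.cast_nonneg _) (mul_self_nonneg _))
    (fun _ _ => mul_nonneg (Nat.cast_nonneg _) (mul_self_nonneg _)) fun _ _ => (by ring : _ = _).le

theorem two_mul_sum_mul_laplacian (hG : ∀ x y, G x y = G y x) (f v : V → ℝ) :
    2 * ∑ x, f x * laplacian G v x = dirichletForm G f v := by
  have hswap : ∑ x, f x * laplacian G v x = ∑ x, ∑ y, (G x y : ℝ) * (f y * (v y - v x)) := by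
    rw [Finset.sum_comm]
    refine Finset.sum_congr rfl fun x _ => ?_
    simp only [laplacian, LinearMap.coe_mk, AddHom.coe_mk, Finset.mul_sum]
    exact Finset.sum_congr rfl fun y _ => by rw [hG x y]; ring
  rw [two_mul]
  nth_rw 2 [hswap]
  simp only [laplacian, LinearMap.coe_mk, AddHom.coe_mk, Finset.mul_sum, dirichletForm,
    ← Finset.sum_add_distrib]
  exact Finset.sum_congr rfl fun x _ => Finset.sum_congr rfl fun y _ => by ring

variable [DecidableEq V] {a b : V}

theorem isUnitVoltage_iff_laplacian_eq {v : V → ℝ} :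
    IsUnitVoltage G a b v ↔ laplacian G v = Pi.single a 1 - Pi.single b 1 := by
  simp only [IsUnitVoltage, funext_iff, laplacian, LinearMap.coe_mk, AddHom.coe_mk, Pi.sub_apply,
    Pi.single_apply]

theorem IsUnitVoltage.dirichletForm_eq {v : V → ℝ} (hv : IsUnitVoltage G a b v)
    (hG : ∀ x y, G x y = G y x) (f : V → ℝ) : dirichletForm G f v = 2 * (f a - f b) := by
  rw [← two_mul_sum_mul_laplacian hG, isUnitVoltage_iff_laplacian_eq.1 hv]
  simp [mul_sub, Pi.single_apply]

/-- If `δ_a - δ_b` were not in the range of the Laplacian, then some `g` would be orthogonal to the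
range and separate `a` from `b`; but such a `g` has no energy. -/
theorem exists_isUnitVoltage (hG : ∀ x y, G x y = G y x)
    (h : ∀ f : V → ℝ, dirichletForm G f f = 0 → f a = f b) : ∃ v, IsUnitVoltage G a b v := by
  suffices Pi.single a 1 - Pi.single b 1 ∈ LinearMap.range (laplacian G) from
    this.imp fun v hv => isUnitVoltage_iff_laplacian_eq.2 hv
  by_contra hnot
  obtain ⟨φ, hφ, hker⟩ := Submodule.exists_le_ker_of_notMem hnot
  obtain ⟨g, rfl⟩ := (dotProductEquiv ℝ V).surjective φ
  have henergy : dirichletForm G g g = 0 := by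
    rw [← two_mul_sum_mul_laplacian hG]
    exact mul_eq_zero_of_right 2 (hker ⟨g, rfl⟩)
  exact hφ (by simp [dotProductEquiv, h g henergy])

theorem effResistance_le (hG : ∀ x y, G x y = G y x) {ρ : ℝ}
    (h : ∀ f : V → ℝ, |f a - f b| ≤ ρ * √(dirichletForm G f f)) :
    effResistance G a b ≤ ENNReal.ofReal (2 * ρ ^ 2) := by
  obtain ⟨v, hv⟩ := exists_isUnitVoltage (a := a) (b := b) hG fun f hf => by
    simpa [hf, sub_eq_zero] using h f
  refine (iInf₂_le v hv).trans (ENNReal.ofReal_le_ofReal ?_)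
  by_contra! hlt
  have hpos : 0 < v a - v b := lt_of_le_of_lt (by positivity) hlt
  have hsq : (v a - v b) ^ 2 ≤ ρ ^ 2 * (2 * (v a - v b)) := by
    rw [← hv.dirichletForm_eq hG, ← Real.sq_sqrt (dirichletForm_self_nonneg v), ← mul_pow,
      ← sq_abs]
    gcongr
    exact h v
  nlinarith

theorem le_effResistance (hG : ∀ x y, G x y = G y x) {E : ℝ} (hE : 0 < E) (f : V → ℝ)
    (hf : dirichletForm G f f ≤ E) :
    ENNReal.ofReal (2 * (f a - f b) ^ 2 / E) ≤ effResistance G a b := by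
  refine le_iInf₂ fun v hv => ENNReal.ofReal_le_ofReal ?_
  have hv0 : 0 ≤ v a - v b := by
    linarith [hv.dirichletForm_eq hG v, dirichletForm_self_nonneg (G := G) v]
  have hcs := dirichletForm_sq_le (G := G) f v
  rw [hv.dirichletForm_eq hG, hv.dirichletForm_eq hG] at hcs
  grw [hf] at hcs
  rw [div_le_iff₀ hE]
  linarith

end Network

section MotherGraph

variable {q : ℕ}

theorem levelEnergy_le_sum_stepCount (j n : ℕ) (f : Word q → ℝ) :
    levelEnergy j n f ≤ ∑ x : List.Vector (Fin (q + 1)) n, ∑ y : List.Vector (Fin (q + 1)) n,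
      (stepCount (q + 1) j x.1 y.1 : ℝ) * (f x.1 - f y.1) ^ 2 := by
  have hnonneg (j : ℕ) (f : Word q → ℝ) (x y : Word q) :
      0 ≤ (stepCount (q + 1) j x y : ℝ) * (f x - f y) ^ 2 := by positivity
  induction n generalizing j f with
  | zero => exact Finset.sum_nonneg fun _ _ => Finset.sum_nonneg fun _ _ => hnonneg j f _ _
  | succ n ih =>
    cases j with
    | zero =>
      refine le_trans ?_ (sum_cons_cons_same_tail_le (hnonneg 0 f) n)
      refine Finset.sum_le_sum fun u _ => Finset.sum_le_sum fun a _ => Finset.sum_le_sum fun b _ =>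
        le_mul_of_one_le_left (sq_nonneg _) ?_
      exact_mod_cast one_le_stepCount_zero_cons a b u.1
    | succ j =>
      refine le_trans ?_ (sum_cons_cons_same_head_le (hnonneg (j + 1) f) n)
      rw [Fin.sum_univ_succ]
      refine add_le_add ((ih _ _).trans ?_) (Finset.sum_le_sum fun a _ => (ih _ _).trans ?_)
      · gcongr
        exact stepCount_le_zero_cons _ _
      · gcongr
        exact stepCount_le_succ_cons a _ _

theorem dirichletForm_motherGraph (d m n : ℕ) (f : List (Fin m) → ℝ) :
    dirichletForm (motherGraph d m n) (fun x => f x.1) (fun x => f x.1)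
      = ∑ j ∈ Finset.range (d + 2), ∑ x : List.Vector (Fin m) n, ∑ y : List.Vector (Fin m) n,
        (stepCount m j x.1 y.1 : ℝ) * (f x.1 - f y.1) ^ 2 := by
  simp only [dirichletForm, motherGraph, ← stepCount.eq_def, Nat.cast_sum, Finset.sum_mul,
    ← pow_two]
  exact (Finset.sum_congr rfl fun x _ => Finset.sum_comm).trans Finset.sum_comm

theorem maxResistance_le_of_resBound {d n : ℕ} {ρ : ℝ} (hρ : 0 ≤ ρ) (h : ResBound q (d + 2) n ρ) :
    maxResistance d (q + 1) n ≤ ENNReal.ofReal (2 * ρ ^ 2) := by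
  refine iSup₂_le fun a b => effResistance_le (motherGraph_comm d (q + 1) n) fun f => ?_
  obtain ⟨F, rfl⟩ : ∃ F : Word q → ℝ, f = fun x => F x.1 :=
    ⟨Function.extend Subtype.val f 0, funext fun x =>
      (Subtype.val_injective.extend_apply f 0 x).symm⟩
  grw [h F a.1 b.1 a.2 b.2, dirichletForm_motherGraph, energy]
  gcongr
  exact levelEnergy_le_sum_stepCount _ n F

end MotherGraph

/-! ### The lower bound in degree zero -/

theorem sum_stepCount_le (m j n : ℕ) [Finite (levelGroup m j)] (x : List (Fin m)) :
    ∑ y : List.Vector (Fin m) n, stepCount m j x y.1 ≤ Nat.card (levelGroup m j) := by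
  simp only [stepCount]
  rw [← Nat.card_sigma]
  refine Nat.card_le_card_of_injective (fun p => p.2.1) ?_
  rintro ⟨y, g, hy⟩ ⟨z, h, hz⟩ rfl
  obtain rfl : y = z := Subtype.ext (hy.symm.trans hz)
  rfl

section Potential

variable {q : ℕ}

/-- The difference of potential between two extensions `a u` and `0 u` of the word `u`, where
`a ≠ 0`. -/
noncomputable def slope : Word q → ℝ
  | [] => 1
  | c :: u => (if c = 0 then (q : ℝ) / (q + 1) else -1 / (q + 1)) * slope u

/-- A potential that is constant along the edges of `L_{0,m}` and, once the words joined by these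
edges are identified, harmonic away from the words `0ⁿ` and `0ⁿ⁻¹ a` with `a ≠ 0`, where its values
are `0` and `1`. -/
noncomputable def potential : Word q → ℝ
  | [] => 0
  | c :: u => potential u + if c = 0 then 0 else slope u

theorem potential_succ_cons_cons (a : Fin q) (c : Fin (q + 1)) (u : Word q) :
    potential (a.succ :: c :: u) = potential u + q / (q + 1) * slope u := by
  have : (q : ℝ) + 1 ≠ 0 := by positivity
  by_cases hc : c = 0
  · simp [potential, slope, hc]
  · simp only [potential, slope, Fin.succ_ne_zero, hc, if_false]
    field_simp
    ring

theorem potential_lam_nil (s : TwoLevel (q + 1)) (u : Word q) :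
    potential (lam [] s u) = potential u := by
  induction u with
  | nil => rfl
  | cons x u ih =>
    cases x using Fin.cases with
    | zero => simpa [lam_zero_cons, potential] using ih
    | succ a =>
      have htop : s.top a.succ ≠ 0 := fun h => s.top_ne_zero a.succ (by simp) (by simp [h])
      obtain ⟨b, hb⟩ := Fin.exists_succ_eq.2 htop
      cases u with
      | nil => simp [lam, lamMap, headMap, potential, htop]
      | cons c u =>
        simp only [lam, Equiv.coe_fn_mk, lamMap, Fin.val_succ, Nat.succ_ne_zero, if_false, headMap,
          ← hb, potential_succ_cons_cons]

theorem sq_potential_cons_sub_le (x y : Fin (q + 1)) (u : Word q) :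
    (potential (x :: u) - potential (y :: u)) ^ 2 ≤ slope u ^ 2 := by
  simp only [potential]
  split_ifs <;> nlinarith [sq_nonneg (slope u)]

theorem sum_sq_slope (n : ℕ) :
    ∑ u : List.Vector (Fin (q + 1)) n, slope u.1 ^ 2 = ((q : ℝ) / (q + 1)) ^ n := by
  have hsq : ((q : ℝ) / (q + 1)) ^ 2 + (-1 / (q + 1)) ^ 2 * q = q / (q + 1) := by
    have : (q : ℝ) + 1 ≠ 0 := by positivity
    field_simp
  induction n with
  | zero => simp [sum_vector_zero fun u => slope u ^ 2, slope]
  | succ n ih =>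
    rw [sum_vector_succ n fun u => slope u ^ 2, Fin.sum_univ_succ]
    simp only [slope, if_true, Fin.succ_ne_zero, if_false, mul_pow]
    simp only [← Finset.mul_sum, ih, Finset.sum_const, Finset.card_univ, Fintype.card_fin,
      nsmul_eq_mul]
    rw [← mul_assoc, ← add_mul, hsq, pow_succ']

theorem sum_stepCount_zero_mul_le (n : ℕ) :
    ∑ x : List.Vector (Fin (q + 1)) (n + 1), ∑ y : List.Vector (Fin (q + 1)) (n + 1),
        (stepCount (q + 1) 0 x.1 y.1 : ℝ) * (potential x.1 - potential y.1) ^ 2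
      ≤ Nat.card (levelGroup (q + 1) 0) * ((q + 1) * ((q : ℝ) / (q + 1)) ^ n) := by
  have hterm (x y : Word q) :
      (stepCount (q + 1) 0 x y : ℝ) * (potential x - potential y) ^ 2
        ≤ stepCount (q + 1) 0 x y * slope x.tail ^ 2 := by
    obtain h | ⟨⟨⟨g, hg⟩, rfl⟩⟩ := isEmpty_or_nonempty {g : levelGroup (q + 1) 0 // g.1 x = y}
    · simp [stepCount]
    · obtain ⟨σ, rfl⟩ := exists_eq_headPerm_of_mem_levelGroup hg
      refine mul_le_mul_of_nonneg_left ?_ (Nat.cast_nonneg _)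
      cases x with
      | nil => simp [headPerm, headMap, sq_nonneg]
      | cons a u => exact sq_potential_cons_sub_le a (σ a) u
  calc _ ≤ ∑ x : List.Vector (Fin (q + 1)) (n + 1), ∑ y : List.Vector (Fin (q + 1)) (n + 1),
          (stepCount (q + 1) 0 x.1 y.1 : ℝ) * slope x.1.tail ^ 2 := by
        exact Finset.sum_le_sum fun x _ => Finset.sum_le_sum fun y _ => hterm x.1 y.1
    _ ≤ ∑ x : List.Vector (Fin (q + 1)) (n + 1),
          (Nat.card (levelGroup (q + 1) 0) : ℝ) * slope x.1.tail ^ 2 := by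
        simp only [← Finset.sum_mul, ← Nat.cast_sum]
        gcongr with x
        exact sum_stepCount_le _ _ _ x.1
    _ = _ := by
        rw [← Finset.mul_sum, sum_vector_succ n fun x => slope x.tail ^ 2]
        simp [sum_sq_slope]

theorem sum_stepCount_one_mul_eq_zero (n : ℕ) :
    ∑ x : List.Vector (Fin (q + 1)) n, ∑ y : List.Vector (Fin (q + 1)) n,
      (stepCount (q + 1) 1 x.1 y.1 : ℝ) * (potential x.1 - potential y.1) ^ 2 = 0 := by
  refine Finset.sum_eq_zero fun x _ => Finset.sum_eq_zero fun y _ => ?_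
  obtain h | ⟨⟨⟨g, hg⟩, hy⟩⟩ := isEmpty_or_nonempty {g : levelGroup (q + 1) 1 // g.1 x.1 = y.1}
  · simp [stepCount]
  · obtain ⟨s, rfl⟩ := exists_eq_lam_nil_of_mem_levelGroup hg
    simp [← hy, potential_lam_nil]

theorem dirichletForm_potential_le (n : ℕ) :
    dirichletForm (motherGraph 0 (q + 1) (n + 1)) (fun x => potential x.1) (fun x => potential x.1)
      ≤ Nat.card (levelGroup (q + 1) 0) * ((q + 1) * ((q : ℝ) / (q + 1)) ^ n) := by
  rw [dirichletForm_motherGraph, Finset.sum_range_succ, Finset.sum_range_one,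
    sum_stepCount_one_mul_eq_zero, add_zero]
  exact sum_stepCount_zero_mul_le n

theorem potential_replicate_append (n : ℕ) (u : Word q) :
    potential (List.replicate n 0 ++ u) = potential u := by
  induction n with
  | zero => rfl
  | succ n ih => simpa [List.replicate_succ, potential] using ih

theorem exists_le_maxResistance_zero [NeZero q] : ∃ c : ℝ, 0 < c ∧ ∀ n : ℕ, 1 ≤ n →
    ENNReal.ofReal (c * growth q ^ n) ≤ maxResistance 0 (q + 1) n := by
  have hq : (0 : ℝ) < q := Nat.cast_pos.2 (NeZero.pos q)
  have hcard : (0 : ℝ) < Nat.card (levelGroup (q + 1) 0) := Nat.cast_pos.2 Nat.card_pos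
  refine ⟨2 / (Nat.card (levelGroup (q + 1) 0) * (q + 1) * growth q), ?_, fun n hn => ?_⟩
  · rw [growth]
    positivity
  obtain ⟨n, rfl⟩ := Nat.exists_eq_add_of_le' hn
  let a : List.Vector (Fin (q + 1)) (n + 1) := ⟨List.replicate n 0 ++ [0], by simp⟩
  let b : List.Vector (Fin (q + 1)) (n + 1) := ⟨List.replicate n 0 ++ [Fin.succ 0], by simp⟩
  have ha : potential a.1 = 0 := by simp [a, potential_replicate_append, potential]
  have hb : potential b.1 = 1 := by simp [b, potential_replicate_append, potential, slope]
  refine le_trans (ENNReal.ofReal_le_ofReal (le_of_eq ?_))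
    ((le_effResistance (a := a) (b := b) (motherGraph_comm 0 (q + 1) (n + 1)) (by positivity)
      (fun x => potential x.1) (dirichletForm_potential_le n)).trans (le_iSup₂_of_le a b le_rfl))
  rw [ha, hb, growth, div_pow, div_pow, pow_succ, pow_succ]
  field_simp
  ring

end Potential

/-! ### The upper bounds -/

section UpperBounds

theorem maxResistance_le_rpow {q d n : ℕ} {A α : ℝ} (hA : 0 ≤ A)
    (h : ResBound q (d + 2) n (A * (n : ℝ) ^ (α / 2))) :
    maxResistance d (q + 1) n ≤ ENNReal.ofReal (2 * A ^ 2 * (n : ℝ) ^ α) := by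
  grw [maxResistance_le_of_resBound (by positivity) h, mul_pow,
    ← Real.rpow_mul_natCast n.cast_nonneg, Nat.cast_two, div_mul_cancel₀ α two_ne_zero, mul_assoc]

variable {q : ℕ} [NeZero q]

theorem exists_resBound_four : ∃ A : ℝ, 0 < A ∧ ∀ n : ℕ, 1 ≤ n →
    ResBound q 4 n (A * (n : ℝ) ^ ((1 - Real.logb (q + 1 : ℝ) q) / 2)) := by
  obtain ⟨A, hA, h⟩ := exists_resBound_three (q := q)
  have hlogb := logb_lt_one (q := q)
  obtain ⟨D, hD, H⟩ := exists_resBound_succ_of_half_lt (by linarith) hA.le h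
  refine ⟨D, hD, fun n hn => ?_⟩
  rw [sub_div, show (1 : ℝ) / 2 = 2 / 2 - 1 / 2 by norm_num, sub_right_comm, ← sub_div]
  exact H n hn

theorem exists_resBound_one_four : ∃ A : ℝ, 0 < A ∧ ∀ n : ℕ, 1 ≤ n →
    ResBound 1 4 n (A * (n : ℝ) ^ (1 / 2 : ℝ)) := by
  simpa using exists_resBound_four (q := 1)

theorem exists_resBound_one_five : ∃ A : ℝ, 0 < A ∧ ∀ n : ℕ, 2 ≤ n →
    ResBound 1 5 n (A * Real.log n) := by
  obtain ⟨A, hA, h⟩ := exists_resBound_one_four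
  exact exists_resBound_succ_of_eq_half hA.le h

theorem exists_resBound_one_six : ∃ A : ℝ, 0 < A ∧ ∀ n : ℕ, 1 ≤ n → ResBound 1 6 n A := by
  obtain ⟨A, hA, hfour⟩ := exists_resBound_one_four
  obtain ⟨B, hB, hfive⟩ := exists_resBound_one_five
  refine exists_resBound_succ_of_lt_half (K := 5) (α := 1 / 4) (C := A + B * 4) (by norm_num)
    (by norm_num) (by positivity) fun n hn => ?_
  obtain rfl | hn := hn.eq_or_lt
  · exact (hfour 1 le_rfl).mono (by norm_num) (by simp [hB.le]) (by positivity)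
  · refine (hfive n hn).mono le_rfl ?_ (by positivity)
    have hlog : Real.log n ≤ 4 * (n : ℝ) ^ (1 / 4 : ℝ) := by
      simpa [mul_comm] using Real.log_le_rpow_div n.cast_nonneg (ε := 1 / 4) (by norm_num)
    grw [hlog, ← mul_assoc]
    gcongr
    exact le_add_of_nonneg_left hA.le

theorem exists_resBound_five (hq : 2 ≤ q) :
    ∃ A : ℝ, 0 < A ∧ ∀ n : ℕ, 1 ≤ n → ResBound q 5 n A := by
  obtain ⟨A, hA, h⟩ := exists_resBound_four (q := q)
  have hq' : (2 : ℝ) ≤ q := by exact_mod_cast hq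
  have hlogb : 0 < Real.logb (q + 1 : ℝ) q := Real.logb_pos (by linarith) (by linarith)
  have hlogb' := logb_lt_one (q := q)
  exact exists_resBound_succ_of_lt_half (by linarith) (by linarith) hA.le h

theorem exists_maxResistance_zero_le : ∃ c : ℝ, 0 < c ∧ ∀ n : ℕ,
    maxResistance 0 (q + 1) n ≤ ENNReal.ofReal (c * growth q ^ n) := by
  obtain ⟨A, hA, h⟩ := exists_resBound_two (q := q)
  refine ⟨2 * A ^ 2, by positivity, fun n => ?_⟩
  grw [maxResistance_le_of_resBound (by positivity) (h n), mul_pow, ← pow_mul, mul_comm n 2,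
    pow_mul, Real.sq_sqrt (zero_lt_one.trans one_lt_growth).le, mul_assoc]

theorem exists_maxResistance_le_rpow {d : ℕ} (hd : d = 1 ∨ d = 2) : ∃ c : ℝ, 0 < c ∧
    ∀ n : ℕ, 1 ≤ n → maxResistance d (q + 1) n
      ≤ ENNReal.ofReal (c * (n : ℝ) ^ (3 - (d : ℝ) - Real.logb (q + 1 : ℝ) q)) := by
  suffices ∃ A : ℝ, 0 < A ∧ ∀ n : ℕ, 1 ≤ n →
      ResBound q (d + 2) n (A * (n : ℝ) ^ ((3 - (d : ℝ) - Real.logb (q + 1 : ℝ) q) / 2)) by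
    obtain ⟨A, hA, h⟩ := this
    exact ⟨2 * A ^ 2, by positivity, fun n hn => maxResistance_le_rpow hA.le (h n hn)⟩
  obtain rfl | rfl := hd
  · convert exists_resBound_three (q := q) using 9
    norm_num
  · convert exists_resBound_four (q := q) using 9
    norm_num

theorem exists_maxResistance_three_two_le_log_sq : ∃ c : ℝ, 0 < c ∧ ∀ n : ℕ, 2 ≤ n →
    maxResistance 3 2 n ≤ ENNReal.ofReal (c * Real.log n ^ 2) := by
  obtain ⟨A, hA, h⟩ := exists_resBound_one_five
  refine ⟨2 * A ^ 2, by positivity, fun n hn => ?_⟩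
  have := maxResistance_le_of_resBound (mul_nonneg hA.le (Real.log_natCast_nonneg n)) (h n hn)
  rwa [mul_pow, ← mul_assoc] at this

theorem exists_maxResistance_le_const {d : ℕ} (h : 4 ≤ d ∨ 3 ≤ d ∧ 2 ≤ q) : ∃ c : ℝ, 0 < c ∧
    ∀ n : ℕ, 1 ≤ n → maxResistance d (q + 1) n ≤ ENNReal.ofReal c := by
  suffices ∃ A : ℝ, 0 < A ∧ ∀ n : ℕ, 1 ≤ n → ResBound q (d + 2) n A by
    obtain ⟨A, hA, h⟩ := this
    exact ⟨2 * A ^ 2, by positivity, fun n hn => maxResistance_le_of_resBound hA.le (h n hn)⟩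
  by_cases hq : 2 ≤ q
  · obtain ⟨A, hA, H⟩ := exists_resBound_five hq
    exact ⟨A, hA, fun n hn => (H n hn).mono (by omega) le_rfl hA.le⟩
  · obtain rfl : q = 1 := by have := NeZero.pos q; omega
    obtain ⟨A, hA, H⟩ := exists_resBound_one_six
    exact ⟨A, hA, fun n hn => (H n hn).mono (by omega) le_rfl hA.le⟩

end UpperBounds

end FractalMother

theorem mainTheorem3 (d m : ℕ) (hm : 2 ≤ m) :
    (∃ c : ℝ, 0 < c ∧
      (d = 0 → ∀ n : ℕ, 1 ≤ n →
        FractalMother.maxResistance d m n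
          ≤ ENNReal.ofReal (c * ((m : ℝ) / ((m : ℝ) - 1)) ^ n)) ∧
      (d = 1 ∨ d = 2 → ∀ n : ℕ, 1 ≤ n →
        FractalMother.maxResistance d m n
          ≤ ENNReal.ofReal (c * (n : ℝ) ^ (3 - (d : ℝ) - Real.logb (m : ℝ) ((m : ℝ) - 1)))) ∧
      (d = 3 ∧ m = 2 → ∀ n : ℕ, 2 ≤ n →
        FractalMother.maxResistance d m n ≤ ENNReal.ofReal (c * Real.log (n : ℝ) ^ 2)) ∧
      (4 ≤ d ∨ (3 ≤ d ∧ 3 ≤ m) → ∀ n : ℕ, 1 ≤ n →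
        FractalMother.maxResistance d m n ≤ ENNReal.ofReal c)) ∧
    (d = 0 → ∃ c : ℝ, 0 < c ∧ ∀ n : ℕ, 1 ≤ n →
      ENNReal.ofReal (c * ((m : ℝ) / ((m : ℝ) - 1)) ^ n)
        ≤ FractalMother.maxResistance d m n) := by
  obtain ⟨q, rfl⟩ : ∃ q, m = q + 1 := ⟨m - 1, by omega⟩
  have : NeZero q := ⟨by omega⟩
  have hq : ((q + 1 : ℕ) : ℝ) - 1 = q := by simp
  have hgrowth : (q + 1 : ℝ) / q = FractalMother.growth q := rfl
  rw [hq, Nat.cast_add_one, hgrowth]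
  refine ⟨?_, fun hd => hd ▸ FractalMother.exists_le_maxResistance_zero⟩
  obtain rfl | hd | ⟨rfl, rfl⟩ | h :
      d = 0 ∨ (d = 1 ∨ d = 2) ∨ (d = 3 ∧ q = 1) ∨ (4 ≤ d ∨ 3 ≤ d ∧ 2 ≤ q) := by omega
  · obtain ⟨c, hc, H⟩ := FractalMother.exists_maxResistance_zero_le (q := q)
    exact ⟨c, hc, fun _ n _ => H n, by omega, by omega, by omega⟩
  · obtain ⟨c, hc, H⟩ := FractalMother.exists_maxResistance_le_rpow (q := q) hd
    exact ⟨c, hc, by omega, fun _ => H, by omega, by omega⟩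
  · obtain ⟨c, hc, H⟩ := FractalMother.exists_maxResistance_three_two_le_log_sq
    exact ⟨c, hc, by omega, by omega, fun _ => H, by omega⟩
  · obtain ⟨c, hc, H⟩ := FractalMother.exists_maxResistance_le_const h
    exact ⟨c, hc, by omega, by omega, by omega, fun _ => H⟩
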